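/- Let $\mathbb K=\mathbb R$ or $\mathbb C$ and let $\ell_p^n$ denote $\mathbb K^n$ with the $\ell_p$ norm; put $1/\infty=0$. For an $m$-linear form $A\colon \ell_{p_1}^n\times\cdots\times\ell_{p_m}^n\to\mathbb K$ let $\|A\|$ be the supremum of $|A(z^{(1)},\dots,z^{(m)})|$ over $\|z^{(j)}\|_{\ell_{p_j}^n}\le 1$, $j=1,\dots,m$. For $p_1,\dots,p_m\in[1,\infty]$, a tuple $(t_1,\dots,t_m)\in(0,\infty)^m$ is called admissible if there is a constant $C$ such that $$\left(\sum_{j_1=1}^n\left(\cdots\left(\sum_{j_m=1}^n|A(e_{j_1},\dots,e_{j_m})|^{t_m}\right)^{\frac{t_{m-1}}{t_m}}\cdots\right)^{\frac{t_1}{t_2}}\right)^{\frac1{t_1}}\le C\|A\|\qquad(\ast)$$ for all positive integers $n$ and all $m$-linear forms $A\colon \ell_{p_1}^n\times\cdots\times\ell_{p_m}^n\to\mathbb K$. It is called globally sharp if it is admissible and, for every $j\in\{1,\dots,m\}$ and every $\varepsilon>0$, the tuple $(t_1,\dots,t_{j-1},t_j-\varepsilon,t_{j+1},\dots,t_m)$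 is not admissible. **Theorem.** Let $m\ge2$. There is a constant $C_m$, depending only on $m$ (and $\mathbb K$), such that the following holds. Let $p_1,\dots,p_m\in[1,\infty]$ with $1/2\le 1/p_1+\cdots+1/p_m<1$, let $k_0=\max\{t: 1/p_t+\cdots+1/p_m\ge 1/2\}$, and let $$s_k=\left[1-\left(\frac1{p_k}+\cdots+\frac1{p_m}\right)\right]^{-1}\ \text{ if } k\le k_0,\qquad s_k=2\ \text{ if } k>k_0 .$$ Then $(\ast)$ holds with $(t_1,\dots,t_m)=(s_1,\dots,s_m)$ and $C=C_m$, for all positive integers $n$ and all $m$-linear forms $A\colon \ell_{p_1}^n\times\cdots\times\ell_{p_m}^n\to\mathbb K$. Moreover: (i) the exponents $s_1,\dots,s_{k_0}$ are optimal: for each $k\le k_0$, $s_k$ is the least value of $t_k$ among all admissible tuples $(t_1,\dots,t_m)$; (ii) if $p_{k_0}\ge2$, then $(s_1,\dots,s_m)$ is globally sharp. -/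

import Mathlib

open scoped ENNReal

noncomputable section

namespace HardyLittlewood

/-- The iterated anisotropic `ℓ_t`-sum
`(∑_{j₁} (∑_{j₂} ⋯ (∑_{j_m} a_{j₁,…,j_m}^{t_m})^{t_{m-1}/t_m} ⋯)^{t₁/t₂})^{1/t₁}`
of a nonnegative array `a`; the first index is the outermost one. -/
def mixedSum {n : ℕ} : {m : ℕ} → (Fin m → ℝ) → ((Fin m → Fin n) → ℝ) → ℝ
  | 0, _, a => a Fin.elim0
  | _ + 1, t, a =>
      (∑ j : Fin n, mixedSum (Fin.tail t) (fun i => a (Fin.cons j i)) ^ t 0) ^ (1 / t 0)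

/-- The space `ℓ_q^n`: `𝕜^n` with the `ℓ_q` norm. -/
abbrev ell (𝕜 : Type*) (q : ℝ≥0∞) (n : ℕ) : Type _ := PiLp q (fun _ : Fin n => 𝕜)

/-- The Hardy–Littlewood inequality with exponents `t` and constant `C`, for all `m`-linear forms on
`ℓ_{p₁}^n × ⋯ × ℓ_{p_m}^n` and all positive integers `n`. The spaces are finite dimensional, so
every `m`-linear form is continuous, and `‖A‖` is the supremum of `|A|` over the product of the
closed unit balls. -/
def HLInequality (𝕜 : Type*) [RCLike 𝕜] {m : ℕ} (p : Fin m → ℝ≥0∞) [∀ k, Fact (1 ≤ p k)]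
    (t : Fin m → ℝ) (C : ℝ) : Prop :=
  ∀ n : ℕ, 0 < n → ∀ A : ContinuousMultilinearMap 𝕜 (fun k => ell 𝕜 (p k) n) 𝕜,
    mixedSum t (fun j => ‖A (fun k => PiLp.single (p k) (j k) (1 : 𝕜))‖) ≤ C * ‖A‖

/-- `t` is an admissible tuple of (positive, finite) exponents: a Hardy–Littlewood inequality holds
with exponents `t` and some constant independent of `n` and of the form. -/
def Admissible (𝕜 : Type*) [RCLike 𝕜] {m : ℕ} (p : Fin m → ℝ≥0∞) [∀ k, Fact (1 ≤ p k)]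
    (t : Fin m → ℝ) : Prop :=
  (∀ k, 0 < t k) ∧ ∃ C : ℝ, HLInequality 𝕜 p t C

/-- `a` is the optimal exponent at position `k`: it is the least value which the `k`-th exponent of
an admissible tuple can take, whatever the other exponents are. -/
def IsOptimalExponent (𝕜 : Type*) [RCLike 𝕜] {m : ℕ} (p : Fin m → ℝ≥0∞) [∀ k, Fact (1 ≤ p k)]
    (k : Fin m) (a : ℝ) : Prop :=
  IsLeast {x : ℝ | ∃ t : Fin m → ℝ, Admissible 𝕜 p t ∧ t k = x} a

/-- `t` is globally sharp: it is admissible, and it is no longer so when any single exponent is made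
smaller. -/
def GloballySharp (𝕜 : Type*) [RCLike 𝕜] {m : ℕ} (p : Fin m → ℝ≥0∞) [∀ k, Fact (1 ≤ p k)]
    (t : Fin m → ℝ) : Prop :=
  Admissible 𝕜 p t ∧
    ∀ (j : Fin m) (ε : ℝ), 0 < ε → ¬ Admissible 𝕜 p (Function.update t j (t j - ε))

/-- `1/p_k + ⋯ + 1/p_m`, with `1/∞ = 0`. -/
def tailSum {m : ℕ} (p : Fin m → ℝ≥0∞) (k : Fin m) : ℝ :=
  ∑ j ∈ Finset.Ici k, ((p j)⁻¹).toReal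

/-- The exponents `s_k`: `[1 - (1/p_k + ⋯ + 1/p_m)]⁻¹` for `k ≤ k₀`, and `2` for `k > k₀`. -/
def hlExponent {m : ℕ} (p : Fin m → ℝ≥0∞) (k₀ k : Fin m) : ℝ :=
  if k ≤ k₀ then (1 - tailSum p k)⁻¹ else 2

end HardyLittlewood

end

/-! Put `r k = 1/p_k`. A vector of the unit ball of `ℓ_{1/r}` is `u * w ^ r` with `|u| ≤ 1` and `w`
a subprobability weight, so a form is an array `a` tested on such data (`FormBound`), and an
`ℓ_{1/(1-α)}` norm is obtained from bounds uniform in the weights `w ^ α` by duality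
(`sum_rpow_le_of_forall_subprob`).

Upper bound. Khintchine's inequality in all variables gives, for every coordinate `i` and all
weights, a weighted mixed `(ℓ₁, ℓ₂)` estimate with constant `(16/9)^m` (`FormBound.sum_sqrt_le`).
The weights are then traded for larger outer exponents, one variable at a time, by Hölder
interpolation between two coordinates (`sum_fiber_rpow_le_one_of_weighted`). This needs the weights
removed to satisfy `∑ r k ≤ 1/2`; one final duality step in the outermost variable has no such
limit, and settles the case where `k₀` is the first index. Each earlier variable is added by the
cotype inequality: iterated `ℓ_t` norms with decreasing exponents at least 2 have cotype `q` with
constant one, so a signed, weighted combination of slices is a form in fewer variables that controls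
the `ℓ_q` sum of the slices, and duality turns `1/q` into `1/q - r 0`
(`mixedSum_le_of_forall_slice`). This step loses no constant.

Optimality. Forms depending on the first variables through one coordinate only reduce everything to
tails of the tuple (`ArrayHL.tail`). The diagonal form gives `1/t_k ≤ 1 - (r_k + ⋯ + r_m)`, which is
optimality for `k ≤ k₀`. When `r_i ≤ 1/2` for all `i ≥ k`, a random-sign form of Euclidean norm
about `√(N log N)` gives `∑_{i ≥ k} (1/t_i + r_i - 1/2) ≤ 1/2` (`ArrayHL.rTail_le`). At `k = k₀` the
tuple `s` attains equality, so no exponent beyond `k₀` can be decreased. -/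

namespace HardyLittlewood

universe u

/-! ### Khintchine's inequality with explicit signs -/

section Khintchine

variable {𝕜 : Type u} [RCLike 𝕜]

/-- The fourth-moment two-point inequality in an inner product space. -/
lemma norm_add_pow_four_add_norm_sub_pow_four_le (𝕜 : Type*) [RCLike 𝕜] {H : Type*}
    [NormedAddCommGroup H] [InnerProductSpace 𝕜 H] (x y : H) :
    ‖x + y‖ ^ 4 + ‖x - y‖ ^ 4 ≤ 2 * (‖x‖ ^ 4 + 6 * ‖x‖ ^ 2 * ‖y‖ ^ 2 + ‖y‖ ^ 4) := by
  have hp := parallelogram_law_with_norm 𝕜 x y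
  have h1 : ‖x + y‖ ≤ ‖x‖ + ‖y‖ := norm_add_le x y
  have h2 : ‖x - y‖ ≤ ‖x‖ + ‖y‖ := norm_sub_le x y
  have h3 : |‖x‖ - ‖y‖| ≤ ‖x - y‖ := abs_norm_sub_norm_le x y
  have h4 : |‖x‖ - ‖y‖| ≤ ‖x + y‖ := by
    have := abs_norm_sub_norm_le x (-y)
    simpa using this
  have h1' : ‖x + y‖ ^ 2 ≤ (‖x‖ + ‖y‖) ^ 2 := by gcongr
  have h2' : ‖x - y‖ ^ 2 ≤ (‖x‖ + ‖y‖) ^ 2 := by gcongr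
  have h3' : (‖x‖ - ‖y‖) ^ 2 ≤ ‖x - y‖ ^ 2 := by
    rw [← sq_abs (‖x‖ - ‖y‖)]; gcongr
  have h4' : (‖x‖ - ‖y‖) ^ 2 ≤ ‖x + y‖ ^ 2 := by
    rw [← sq_abs (‖x‖ - ‖y‖)]; gcongr
  have h5 : (‖x + y‖ ^ 2 - ‖x - y‖ ^ 2) ^ 2 ≤ (4 * (‖x‖ * ‖y‖)) ^ 2 := by
    apply sq_le_sq'
    · nlinarith
    · nlinarith
  have h6 : (‖x + y‖ ^ 2 + ‖x - y‖ ^ 2) ^ 2 = (2 * (‖x‖ ^ 2 + ‖y‖ ^ 2)) ^ 2 := by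
    have h : ‖x + y‖ ^ 2 + ‖x - y‖ ^ 2 = 2 * (‖x‖ ^ 2 + ‖y‖ ^ 2) := by linarith
    rw [h]
  nlinarith

/-- For random signs `E‖X‖² = ∑ ‖v j‖²` and `E‖X‖⁴ ≤ 3 (E‖X‖²)²`, so the left side bounds the mean
of the right side from below. Choosing the signs one by one replaces the expectation; one choice
serves all `l` because only the total over `l` is compared. -/
lemma exists_signs_moments_le {H : Type*} [NormedAddCommGroup H] [InnerProductSpace 𝕜 H]
    {L J : Type*} [Fintype L] [DecidableEq J] (v : L → J → H) (s : Finset J) (B : L → ℝ)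
    (hB : ∀ l, 0 ≤ B l) (A : L → ℝ) :
    ∃ ε : J → 𝕜, (∀ j, ε j = 1 ∨ ε j = -1) ∧
      ∑ l, (A l * ∑ j ∈ s, ‖v l j‖ ^ 2 - 3 * B l * (∑ j ∈ s, ‖v l j‖ ^ 2) ^ 2) ≤
        ∑ l, (A l * ‖∑ j ∈ s, ε j • v l j‖ ^ 2 - B l * ‖∑ j ∈ s, ε j • v l j‖ ^ 4) := by
  induction s using Finset.induction_on generalizing A with
  | empty => exact ⟨fun _ => 1, fun _ => Or.inl rfl, by simp⟩
  | insert i s hi ih =>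
    -- Averaging the fourth power over the sign of the new vector produces at most `6‖X‖²‖v l i‖²`
    -- as cross term, which is absorbed into the quadratic coefficient; hence `A` varies in the
    -- induction.
    obtain ⟨ε, hε, h⟩ := ih (fun l => A l - 6 * B l * ‖v l i‖ ^ 2)
    set X : L → H := fun l => ∑ j ∈ s, ε j • v l j with hX
    set Q : L → ℝ := fun l => ∑ j ∈ s, ‖v l j‖ ^ 2 with hQ
    have key : 2 * ∑ l, (A l * (‖v l i‖ ^ 2 + Q l) - 3 * B l * (‖v l i‖ ^ 2 + Q l) ^ 2) ≤
        ∑ l, (A l * ‖X l + v l i‖ ^ 2 - B l * ‖X l + v l i‖ ^ 4) +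
        ∑ l, (A l * ‖X l - v l i‖ ^ 2 - B l * ‖X l - v l i‖ ^ 4) := by
      have h1 : ∑ l, (A l * (‖v l i‖ ^ 2 + Q l) - 3 * B l * (‖v l i‖ ^ 2 + Q l) ^ 2) ≤
          ∑ l, ((A l - 6 * B l * ‖v l i‖ ^ 2) * Q l - 3 * B l * Q l ^ 2) +
          ∑ l, (A l * ‖v l i‖ ^ 2 - B l * ‖v l i‖ ^ 4) := by
        rw [← Finset.sum_add_distrib]
        refine Finset.sum_le_sum fun l _ => ?_
        nlinarith [mul_nonneg (hB l) (by positivity : 0 ≤ ‖v l i‖ ^ 4)]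
      have h2 : 2 * (∑ l, ((A l - 6 * B l * ‖v l i‖ ^ 2) * ‖X l‖ ^ 2 - B l * ‖X l‖ ^ 4) +
          ∑ l, (A l * ‖v l i‖ ^ 2 - B l * ‖v l i‖ ^ 4)) ≤
          ∑ l, (A l * ‖X l + v l i‖ ^ 2 - B l * ‖X l + v l i‖ ^ 4) +
          ∑ l, (A l * ‖X l - v l i‖ ^ 2 - B l * ‖X l - v l i‖ ^ 4) := by
        rw [← Finset.sum_add_distrib, ← Finset.sum_add_distrib, Finset.mul_sum]
        refine Finset.sum_le_sum fun l _ => ?_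
        have p := parallelogram_law_with_norm 𝕜 (X l) (v l i)
        have q := mul_le_mul_of_nonneg_left
          (norm_add_pow_four_add_norm_sub_pow_four_le 𝕜 (X l) (v l i)) (hB l)
        have p' := congrArg (A l * ·) p
        nlinarith
      linarith
    have hsum : ∀ (η : 𝕜) (l : L), ∑ j ∈ insert i s, Function.update ε i η j • v l j
        = X l + η • v l i := by
      intro η l
      rw [Finset.sum_insert hi, add_comm, Function.update_self]
      congr 1
      refine Finset.sum_congr rfl fun j hj => ?_
      rw [Function.update_of_ne (ne_of_mem_of_not_mem hj hi)]
    have hsgn : ∀ η : 𝕜, (η = 1 ∨ η = -1) → ∀ j, Function.update ε i η j = 1 ∨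
        Function.update ε i η j = -1 := by
      intro η hη j
      by_cases hj : j = i
      · subst hj; simpa using hη
      · simpa [Function.update_of_ne hj] using hε j
    rcases le_total (∑ l, (A l * (‖v l i‖ ^ 2 + Q l) - 3 * B l * (‖v l i‖ ^ 2 + Q l) ^ 2))
      (∑ l, (A l * ‖X l + v l i‖ ^ 2 - B l * ‖X l + v l i‖ ^ 4)) with h' | h'
    · refine ⟨Function.update ε i 1, hsgn 1 (Or.inl rfl), ?_⟩
      simp only [hsum, one_smul]
      simp only [Finset.sum_insert hi]
      exact h'
    · refine ⟨Function.update ε i (-1), hsgn (-1) (Or.inr rfl), ?_⟩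
      simp only [hsum, neg_smul, one_smul, ← sub_eq_add_neg]
      simp only [Finset.sum_insert hi]
      linarith

/-- Khintchine's inequality for a finite family of sums of vectors of an inner product space, with
one choice of signs. -/
lemma exists_signs_sum_norm_ge {H : Type*} [NormedAddCommGroup H] [InnerProductSpace 𝕜 H]
    {L J : Type*} [Fintype L] [Fintype J] (v : L → J → H) :
    ∃ ε : J → 𝕜, (∀ j, ε j = 1 ∨ ε j = -1) ∧
      9 / 16 * ∑ l, √(∑ j, ‖v l j‖ ^ 2) ≤ ∑ l, ‖∑ j, ε j • v l j‖ := by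
  classical
  set σ : L → ℝ := fun l => √(∑ j, ‖v l j‖ ^ 2) with hσ
  have hσ0 : ∀ l, 0 ≤ σ l := fun l => Real.sqrt_nonneg _
  have hσ2 : ∀ l, ∑ j, ‖v l j‖ ^ 2 = σ l ^ 2 := fun l => (Real.sq_sqrt (by positivity)).symm
  -- These coefficients make `3 s²/(4σ) - s⁴/(16σ³)` a minorant of `s ≥ 0`, tangent to it at `s =
  -- 2σ`; the moment bound gives it the value `(3/4 - 3/16) σ = 9σ/16`. If `σ l = 0`, division by
  -- zero makes both coefficients vanish.
  obtain ⟨ε, hε, h⟩ := exists_signs_moments_le (𝕜 := 𝕜) v Finset.univ (fun l => 1 / (16 * σ l ^ 3))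
    (fun l => by have := hσ0 l; positivity) (fun l => 3 / (4 * σ l))
  refine ⟨ε, hε, ?_⟩
  calc 9 / 16 * ∑ l, σ l = ∑ l, (3 / (4 * σ l) * ∑ j, ‖v l j‖ ^ 2 -
        3 * (1 / (16 * σ l ^ 3)) * (∑ j, ‖v l j‖ ^ 2) ^ 2) := by
        rw [Finset.mul_sum]
        refine Finset.sum_congr rfl fun l _ => ?_
        rw [hσ2]
        rcases (hσ0 l).eq_or_lt with h0 | h0
        · rw [← h0]; simp
        · field_simp; ring
    _ ≤ _ := h
    _ ≤ _ := by
        refine Finset.sum_le_sum fun l _ => ?_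
        set s := ‖∑ j, ε j • v l j‖
        have hs : 0 ≤ s := norm_nonneg _
        rcases (hσ0 l).eq_or_lt with h0 | h0
        · rw [← h0]; simpa using hs
        · have e : s - (3 / (4 * σ l) * s ^ 2 - 1 / (16 * σ l ^ 3) * s ^ 4) =
              s * ((s - 2 * σ l) ^ 2 * (s + 4 * σ l)) / (16 * σ l ^ 3) := by
            field_simp; ring
          have : 0 ≤ s * ((s - 2 * σ l) ^ 2 * (s + 4 * σ l)) / (16 * σ l ^ 3) := by positivity
          linarith

lemma sum_fin_succ_pi {M : Type*} [AddCommMonoid M] {m n : ℕ} (f : (Fin (m + 1) → Fin n) → M) :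
    ∑ j, f j = ∑ l, ∑ i, f (Fin.cons l i) := by
  rw [← Fintype.sum_prod_type' (f := fun l i => f (Fin.cons l i))]
  exact ((Fin.consEquiv fun _ => Fin n).sum_comp f).symm

/-- Khintchine's inequality for decoupled multilinear sums. -/
lemma exists_multi_signs_sum_norm_ge {n : ℕ} (m : ℕ) {H : Type u} [NormedAddCommGroup H]
    [InnerProductSpace 𝕜 H] {L : Type*} [Fintype L] (v : L → (Fin m → Fin n) → H) :
    ∃ ε : Fin m → Fin n → 𝕜, (∀ k l, ε k l = 1 ∨ ε k l = -1) ∧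
      (9 / 16) ^ m * ∑ l, √(∑ j, ‖v l j‖ ^ 2) ≤ ∑ l, ‖∑ j, (∏ k, ε k (j k)) • v l j‖ := by
  induction m generalizing H with
  | zero => exact ⟨fun _ _ => 1, fun _ _ => Or.inl rfl, by simp [Real.sqrt_sq]⟩
  | succ m ih =>
    -- Bundling the first index into an `ℓ₂`-valued vector makes the remaining signs independent of
    -- it; the norms that come out are the square functions needed for Khintchine in the first
    -- variable.
    obtain ⟨ε', hε', h'⟩ := ih (H := PiLp 2 fun _ : Fin n => H)
      (fun l i => WithLp.toLp 2 fun l₀ => v l (Fin.cons l₀ i))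
    obtain ⟨ε₀, hε₀, h₀⟩ := exists_signs_sum_norm_ge (𝕜 := 𝕜)
      (fun l (l₀ : Fin n) => ∑ i : Fin m → Fin n, (∏ k, ε' k (i k)) • v l (Fin.cons l₀ i))
    refine ⟨Fin.cons ε₀ ε', fun k => ?_, ?_⟩
    · refine Fin.cases ?_ (fun k => ?_) k
      · simpa using hε₀
      · simpa using hε' k
    · have e1 : ∀ l, ∑ j, ‖v l j‖ ^ 2 =
          ∑ i, ‖(WithLp.toLp 2 fun l₀ => v l (Fin.cons l₀ i) : PiLp 2 fun _ : Fin n => H)‖ ^ 2 := by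
        intro l
        rw [sum_fin_succ_pi, Finset.sum_comm]
        simp [PiLp.norm_sq_eq_of_L2]
      have e2 : ∀ l, ‖∑ i : Fin m → Fin n, (∏ k, ε' k (i k)) •
          (WithLp.toLp 2 fun l₀ => v l (Fin.cons l₀ i) : PiLp 2 fun _ : Fin n => H)‖ =
          √(∑ l₀, ‖∑ i : Fin m → Fin n, (∏ k, ε' k (i k)) • v l (Fin.cons l₀ i)‖ ^ 2) := by
        intro l
        rw [PiLp.norm_eq_of_L2]
        simp
      have e3 : ∀ l, ∑ j : Fin (m + 1) → Fin n,
          (∏ k, (Fin.cons ε₀ ε' : Fin (m + 1) → Fin n → 𝕜) k (j k)) • v l j =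
          ∑ l₀, ε₀ l₀ • ∑ i : Fin m → Fin n, (∏ k, ε' k (i k)) • v l (Fin.cons l₀ i) := by
        intro l
        rw [sum_fin_succ_pi]
        simp [Fin.prod_univ_succ, Finset.smul_sum, mul_smul]
      simp only [e1, e3]
      simp only [e2] at h'
      rw [pow_succ', mul_assoc]
      exact (mul_le_mul_of_nonneg_left h' (by norm_num)).trans h₀

end Khintchine

/-! ### Duality, and trading weights for exponents -/

/-- Nonnegative weights of total mass at most one. -/
def IsSubprob {n : ℕ} (w : Fin n → ℝ) : Prop := (∀ l, 0 ≤ w l) ∧ ∑ l, w l ≤ 1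

lemma isSubprob_zero {n : ℕ} : IsSubprob (fun _ : Fin n => (0 : ℝ)) := by
  constructor <;> simp

/-- Duality between `ℓ_{1/α}` and `ℓ_{1/(1-α)}` for nonnegative vectors. -/
lemma sum_rpow_le_of_forall_subprob {n : ℕ} {v : Fin n → ℝ} (hv : ∀ l, 0 ≤ v l) {α E : ℝ}
    (h1 : α < 1) (h : ∀ w, IsSubprob w → ∑ l, w l ^ α * v l ≤ E) :
    ∑ l, v l ^ (1 / (1 - α)) ≤ E ^ (1 / (1 - α)) := by
  have hα : 0 < 1 - α := by linarith
  set γ := 1 / (1 - α) with hγ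
  have hγ0 : 0 < γ := by positivity
  have hγα : γ * α + 1 = γ := by rw [hγ]; field_simp; ring
  have hE : 0 ≤ E := (Finset.sum_nonneg fun l _ => mul_nonneg (by positivity) (hv l)).trans
    (h _ isSubprob_zero)
  set V := ∑ l, v l ^ γ with hV
  have hV0 : 0 ≤ V := Finset.sum_nonneg fun l _ => Real.rpow_nonneg (hv l) _
  rcases hV0.eq_or_lt with hV1 | hV1
  · rw [← hV1]; positivity
  -- The extremal weight in Hölder's inequality.
  have hw : IsSubprob fun l => v l ^ γ / V := by
    refine ⟨fun l => div_nonneg (Real.rpow_nonneg (hv l) _) hV0, ?_⟩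
    rw [← Finset.sum_div, div_self hV1.ne']
  have h2 := h _ hw
  have e : ∑ l, (v l ^ γ / V) ^ α * v l = V ^ (1 - α) := by
    have : ∀ l, (v l ^ γ / V) ^ α * v l = v l ^ γ / V ^ α := by
      intro l
      rw [Real.div_rpow (Real.rpow_nonneg (hv l) _) hV0, ← Real.rpow_mul (hv l), div_mul_eq_mul_div,
        ← Real.rpow_add_one' (hv l) (by rw [hγα]; exact hγ0.ne'), hγα]
    simp only [this]
    rw [← Finset.sum_div, Real.rpow_sub hV1, Real.rpow_one]
  rw [e] at h2
  calc V = (V ^ (1 - α)) ^ γ := by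
        rw [← Real.rpow_mul hV0, hγ, mul_one_div_cancel hα.ne', Real.rpow_one]
    _ ≤ E ^ γ := by gcongr

/-- Hölder's inequality in interpolation form. -/
lemma sum_rpow_mul_rpow_le {ι : Type*} (s : Finset ι) {a b : ι → ℝ} (ha : ∀ i, 0 ≤ a i)
    (hb : ∀ i, 0 ≤ b i) {θ : ℝ} (h0 : 0 ≤ θ) (h1 : θ ≤ 1) :
    ∑ i ∈ s, a i ^ θ * b i ^ (1 - θ) ≤ (∑ i ∈ s, a i) ^ θ * (∑ i ∈ s, b i) ^ (1 - θ) := by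
  rcases h0.eq_or_lt with rfl | h0
  · simp
  rcases h1.eq_or_lt with rfl | h1
  · simp
  have hpq : (1 / θ).HolderConjugate (1 / (1 - θ)) := by
    rw [Real.holderConjugate_iff]
    refine ⟨by rw [lt_div_iff₀ h0]; linarith, by simp⟩
  have := Real.inner_le_Lp_mul_Lq_of_nonneg s hpq (f := fun i => a i ^ θ)
    (g := fun i => b i ^ (1 - θ)) (fun i _ => Real.rpow_nonneg (ha i) _)
    (fun i _ => Real.rpow_nonneg (hb i) _)
  have e1 : ∀ i, (a i ^ θ) ^ (1 / θ) = a i := fun i => by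
    rw [← Real.rpow_mul (ha i), mul_one_div_cancel h0.ne', Real.rpow_one]
  have e2 : ∀ i, (b i ^ (1 - θ)) ^ (1 / (1 - θ)) = b i := fun i => by
    rw [← Real.rpow_mul (hb i), mul_one_div_cancel (by linarith), Real.rpow_one]
  simpa only [e1, e2, one_div_one_div] using this

lemma sum_mul_comp_fiber {J : Type*} [Fintype J] {n : ℕ} (f : J → Fin n) (c : J → ℝ)
    (F : Fin n → ℝ) : ∑ j, c j * F (f j) = ∑ l, (∑ j with f j = l, c j) * F l := by
  rw [← Finset.sum_fiberwise Finset.univ f]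
  refine Finset.sum_congr rfl fun l _ => ?_
  rw [Finset.sum_mul]
  refine Finset.sum_congr rfl fun j hj => ?_
  rw [(Finset.mem_filter.1 hj).2]

lemma rpow_sub_one_mul_self {x β : ℝ} (hx : 0 ≤ x) (hβ : β ≠ 0) : x * x ^ (β - 1) = x ^ β := by
  rcases hx.eq_or_lt with rfl | hx
  · simp [Real.zero_rpow hβ]
  · rw [Real.rpow_sub_one hx.ne']; field_simp

/-- Raising the exponent: a bound for all weighted sums over the fibres of `f`, the weights being
constant on the fibres of `g`, and a bound over the fibres of `g` give a bound over the fibres of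
`f`. -/
lemma sum_fiber_rpow_le_one_of_weighted {J : Type*} [Fintype J] {n : ℕ} (f g : J → Fin n)
    {c : J → ℝ} (hc : ∀ j, 0 ≤ c j) {α β : ℝ} (hα : 0 < α) (hαβ : α ≤ β) (hβ : β ≤ 1)
    (hf : ∀ w, IsSubprob w → ∑ l, (∑ j with f j = l, c j * w (g j) ^ (1 / α - 1 / β)) ^ α ≤ 1)
    (hg : ∑ l, (∑ j with g j = l, c j) ^ β ≤ 1) :
    ∑ l, (∑ j with f j = l, c j) ^ β ≤ 1 := by
  rcases hαβ.eq_or_lt with rfl | hαβ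
  · simpa using hf _ isSubprob_zero
  have hβ0 : 0 < β := hα.trans hαβ
  have hα1 : α < 1 := hαβ.trans_le hβ
  set S : Fin n → ℝ := fun l => ∑ j with f j = l, c j with hS
  set T : Fin n → ℝ := fun l => ∑ j with g j = l, c j with hT
  set U : Fin n → ℝ := fun l => ∑ j with g j = l, c j * S (f j) ^ (α - 1) with hU
  have hS0 : ∀ l, 0 ≤ S l := fun l => Finset.sum_nonneg fun j _ => hc j
  have hT0 : ∀ l, 0 ≤ T l := fun l => Finset.sum_nonneg fun j _ => hc j
  have hcS : ∀ j, 0 ≤ c j * S (f j) ^ (α - 1) := fun j =>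
    mul_nonneg (hc j) (Real.rpow_nonneg (hS0 _) _)
  have hU0 : ∀ l, 0 ≤ U l := fun l => Finset.sum_nonneg fun j _ => hcS j
  -- By duality it suffices to pair `U` with `w ^ (1 - α/β)`. Regrouped over the fibres of `f`,
  -- Hölder with exponents `α` and `1 - α` yields the sums of `hf` times `S ^ (1 - α)`, which
  -- cancels `S ^ (α - 1)`.
  have hUsum : ∑ l, U l ^ (β / α) ≤ 1 := by
    have h1 : ∀ w, IsSubprob w → ∑ l, w l ^ (1 - α / β) * U l ≤ 1 := by
      intro w hw
      refine le_trans ?_ (hf w hw)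
      calc ∑ l, w l ^ (1 - α / β) * U l
          = ∑ l, U l * w l ^ (1 - α / β) := by simp only [mul_comm]
        _ = ∑ j, c j * S (f j) ^ (α - 1) * w (g j) ^ (1 - α / β) :=
            (sum_mul_comp_fiber g _ _).symm
        _ = ∑ j, c j * w (g j) ^ (1 - α / β) * S (f j) ^ (α - 1) := by
            refine Finset.sum_congr rfl fun j _ => by ring
        _ = ∑ l, (∑ j with f j = l, c j * w (g j) ^ (1 - α / β)) * S l ^ (α - 1) :=
            sum_mul_comp_fiber f (fun j => c j * w (g j) ^ (1 - α / β)) fun l => S l ^ (α - 1)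
        _ ≤ _ := by
            refine Finset.sum_le_sum fun l _ => ?_
            have hx : ∀ j, 0 ≤ c j * w (g j) ^ (1 / α - 1 / β) := fun j =>
              mul_nonneg (hc j) (Real.rpow_nonneg (hw.1 _) _)
            have h2 := sum_rpow_mul_rpow_le (Finset.univ.filter fun j => f j = l) hx hc hα.le hα1.le
            have h3 : ∀ j, (c j * w (g j) ^ (1 / α - 1 / β)) ^ α * c j ^ (1 - α) =
                c j * w (g j) ^ (1 - α / β) := by
              intro j
              rw [Real.mul_rpow (hc j) (Real.rpow_nonneg (hw.1 _) _), ← Real.rpow_mul (hw.1 _),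
                mul_right_comm, ← Real.rpow_add' (hc j) (by norm_num)]
              have e1 : α + (1 - α) = 1 := by ring
              have e2 : (1 / α - 1 / β) * α = 1 - α / β := by field_simp
              rw [e1, e2, Real.rpow_one]
            simp only [h3] at h2
            have h4 : S l ^ (1 - α) * S l ^ (α - 1) ≤ 1 := by
              rcases (hS0 l).eq_or_lt with h | h
              · rw [← h, Real.zero_rpow (by linarith)]; simp
              · rw [← Real.rpow_add h]; simp
            have h5 : 0 ≤ (∑ j with f j = l, c j * w (g j) ^ (1 / α - 1 / β)) ^ α :=
              Real.rpow_nonneg (Finset.sum_nonneg fun j _ => hx j) _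
            calc _ ≤ ((∑ j with f j = l, c j * w (g j) ^ (1 / α - 1 / β)) ^ α * S l ^ (1 - α)) *
                  S l ^ (α - 1) := by
                  have := Real.rpow_nonneg (hS0 l) (α - 1)
                  gcongr
              _ = (∑ j with f j = l, c j * w (g j) ^ (1 / α - 1 / β)) ^ α *
                  (S l ^ (1 - α) * S l ^ (α - 1)) := by ring
              _ ≤ _ := mul_le_of_le_one_right h5 h4
    have h2 := sum_rpow_le_of_forall_subprob hU0 (α := 1 - α / β)
      (by have : 0 < α / β := by positivity
          linarith) h1
    have e : 1 / (1 - (1 - α / β)) = β / α := by rw [sub_sub_cancel, one_div_div]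
    simpa only [e, Real.one_rpow] using h2
  -- Chosen so that `(α - 1) θ = β - 1`: then `c * S ^ (β - 1)` interpolates between the summands of
  -- `U` and of `T`, and Hölder over `l` meets the bounds on `∑ U ^ (β/α)` and `∑ T ^ β`.
  set θ := (1 - β) / (1 - α) with hθ
  have hα' : 0 < 1 - α := by linarith
  have hθ0 : 0 ≤ θ := div_nonneg (by linarith) hα'.le
  have hθ1 : θ ≤ 1 := by rw [hθ, div_le_one hα']; linarith
  have hθβ : 1 - θ * α / β = (1 - θ) / β := by
    have : θ * (1 - α) = 1 - β := by rw [hθ]; field_simp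
    field_simp
    linarith
  calc ∑ l, S l ^ β = ∑ l, S l * S l ^ (β - 1) :=
        Finset.sum_congr rfl fun l _ => (rpow_sub_one_mul_self (hS0 l) hβ0.ne').symm
    _ = ∑ j, c j * S (f j) ^ (β - 1) := (sum_mul_comp_fiber f c fun l => S l ^ (β - 1)).symm
    _ = ∑ l, ∑ j with g j = l, c j * S (f j) ^ (β - 1) := (Finset.sum_fiberwise _ g _).symm
    _ ≤ ∑ l, U l ^ θ * T l ^ (1 - θ) := by
        refine Finset.sum_le_sum fun l _ => ?_
        refine le_trans (le_of_eq ?_) (sum_rpow_mul_rpow_le _ hcS hc hθ0 hθ1)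
        refine Finset.sum_congr rfl fun j _ => ?_
        rw [Real.mul_rpow (hc j) (Real.rpow_nonneg (hS0 _) _), ← Real.rpow_mul (hS0 _),
          mul_right_comm, ← Real.rpow_add' (hc j) (by norm_num)]
        have e1 : θ + (1 - θ) = 1 := by ring
        have e2 : (α - 1) * θ = β - 1 := by rw [hθ]; field_simp; ring
        rw [e1, e2, Real.rpow_one]
    _ = ∑ l, (U l ^ (β / α)) ^ (θ * α / β) * (T l ^ β) ^ (1 - θ * α / β) := by
        refine Finset.sum_congr rfl fun l _ => ?_
        rw [hθβ, ← Real.rpow_mul (hU0 l), ← Real.rpow_mul (hT0 l)]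
        congr 2 <;> field_simp
    _ ≤ (∑ l, U l ^ (β / α)) ^ (θ * α / β) * (∑ l, T l ^ β) ^ (1 - θ * α / β) := by
        refine sum_rpow_mul_rpow_le _ (fun l => Real.rpow_nonneg (hU0 l) _)
          (fun l => Real.rpow_nonneg (hT0 l) _) (by positivity) ?_
        have : 0 ≤ (1 - θ) / β := div_nonneg (by linarith) hβ0.le
        linarith
    _ ≤ 1 := by
        refine mul_le_one₀ ?_ (Real.rpow_nonneg (Finset.sum_nonneg fun l _ =>
          Real.rpow_nonneg (hT0 l) _) _) ?_
        · exact Real.rpow_le_one (Finset.sum_nonneg fun l _ => Real.rpow_nonneg (hU0 l) _) hUsum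
            (by positivity)
        · refine Real.rpow_le_one (Finset.sum_nonneg fun l _ => Real.rpow_nonneg (hT0 l) _) hg ?_
          rw [hθβ]
          exact div_nonneg (by linarith) hβ0.le

/-- Removing the weight of variable `q` lowers the reciprocal of the exponent by `2 * r q`, starting
from `2`. All coordinates `i` are treated together since the step for `i` uses the estimate for
coordinate `q`. The bound on `∑ r k` keeps the exponents at most one. -/
lemma sum_fiber_rpow_le_one_of_forall_weights {m n : ℕ} {r : Fin m → ℝ} (hr : ∀ k, 0 ≤ r k)
    (K : Finset (Fin m)) (hK : ∑ k ∈ K, r k ≤ 1 / 2) {c : (Fin m → Fin n) → ℝ} (hc : ∀ j, 0 ≤ c j)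
    (h : ∀ w : Fin m → Fin n → ℝ, (∀ k, IsSubprob (w k)) → ∀ i, ∑ l,
      (∑ j with j i = l, c j * ∏ k ∈ K, w k (j k) ^ (2 * r k)) ^ (1 / 2 : ℝ) ≤ 1) (i : Fin m) :
    ∑ l, (∑ j with j i = l, c j) ^ (1 / (2 * (1 - ∑ k ∈ K, r k))) ≤ 1 := by
  induction K using Finset.induction_on generalizing c i with
  | empty => simpa using h (fun _ _ => 0) (fun _ => isSubprob_zero) i
  | insert q K hq ih =>
    rw [Finset.sum_insert hq] at hK
    set σ := ∑ k ∈ K, r k with hσ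
    have hσ0 : 0 ≤ σ := Finset.sum_nonneg fun k _ => hr k
    have hrq := hr q
    set α := 1 / (2 * (1 - σ)) with hα
    set β := 1 / (2 * (1 - (r q + σ))) with hβ
    have h1 : 0 < 2 * (1 - (r q + σ)) := by linarith
    have h2 : 0 < 2 * (1 - σ) := by linarith
    have hα0 : 0 < α := by positivity
    have hβ0 : 0 < β := by positivity
    have hαβ : α ≤ β := one_div_le_one_div_of_le h1 (by linarith)
    have hβ1 : β ≤ 1 := by rw [hβ, div_le_one h1]; linarith
    have e : 1 / α - 1 / β = 2 * r q := by rw [hα, hβ, one_div_one_div, one_div_one_div]; ring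
    have main : ∀ w, IsSubprob w → ∀ i : Fin m,
        ∑ l, (∑ j with j i = l, c j * w (j q) ^ (1 / α - 1 / β)) ^ α ≤ 1 := by
      intro w hw i
      rw [e]
      refine ih (by linarith) (c := fun j => c j * w (j q) ^ (2 * r q))
        (fun j => mul_nonneg (hc j) (Real.rpow_nonneg (hw.1 _) _)) (fun w' hw' i => ?_) i
      have := h (Function.update w' q w) (fun k => ?_) i
      · refine le_trans (le_of_eq (Finset.sum_congr rfl fun l _ => ?_)) this
        congr 1
        refine Finset.sum_congr rfl fun j _ => ?_
        rw [Finset.prod_insert hq, Function.update_self, ← mul_assoc]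
        congr 1
        refine Finset.prod_congr rfl fun k hk => ?_
        rw [Function.update_of_ne (ne_of_mem_of_not_mem hk hq)]
      · by_cases hk : k = q
        · subst hk; simpa using hw
        · simpa [Function.update_of_ne hk] using hw' k
    -- On the fibres of coordinate `q` itself the weight is constant, so duality alone raises the
    -- exponent.
    have hg : ∑ l, (∑ j with j q = l, c j) ^ β ≤ 1 := by
      have hT0 : ∀ l : Fin n, 0 ≤ ∑ j : Fin m → Fin n with j q = l, c j := fun l =>
        Finset.sum_nonneg fun j _ => hc j
      have e2 : (1 / α - 1 / β) * α = 1 - α / β := by field_simp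
      have := sum_rpow_le_of_forall_subprob
        (v := fun l => (∑ j : Fin m → Fin n with j q = l, c j) ^ α)
        (fun l => Real.rpow_nonneg (hT0 l) _)
        (α := 1 - α / β) (E := 1)
        (by have : 0 < α / β := by positivity
            linarith) (fun w hw => ?_)
      · rw [sub_sub_cancel, one_div_div, Real.one_rpow] at this
        refine le_trans (le_of_eq (Finset.sum_congr rfl fun l _ => ?_)) this
        rw [← Real.rpow_mul (hT0 l)]
        congr 1
        field_simp
      · refine le_trans (le_of_eq (Finset.sum_congr rfl fun l _ => ?_)) (main w hw q)
        rw [← e2, Real.rpow_mul (hw.1 l), ← Real.mul_rpow (Real.rpow_nonneg (hw.1 l) _) (hT0 l),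
          Finset.mul_sum]
        congr 1
        refine Finset.sum_congr rfl fun j hj => ?_
        rw [(Finset.mem_filter.1 hj).2, mul_comm]
    rw [Finset.sum_insert hq]
    exact sum_fiber_rpow_le_one_of_weighted (fun j : Fin m → Fin n => j i) (fun j => j q) hc hα0 hαβ
      hβ1 (fun w hw => main w hw i) hg

/-! ### Iterated sums and their cotype -/

section MixedSum

variable {n m : ℕ}

lemma mixedSum_zero (t : Fin 0 → ℝ) (a : (Fin 0 → Fin n) → ℝ) :
    mixedSum t a = a Fin.elim0 := rfl

lemma mixedSum_succ (t : Fin (m + 1) → ℝ) (a : (Fin (m + 1) → Fin n) → ℝ) :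
    mixedSum t a =
      (∑ l, mixedSum (Fin.tail t) (fun i => a (Fin.cons l i)) ^ t 0) ^ (1 / t 0) := rfl

lemma mixedSum_nonneg (t : Fin m → ℝ) {a : (Fin m → Fin n) → ℝ} (ha : ∀ j, 0 ≤ a j) :
    0 ≤ mixedSum t a := by
  induction m with
  | zero => exact ha _
  | succ m ih =>
    rw [mixedSum_succ]
    exact Real.rpow_nonneg (Finset.sum_nonneg fun l _ =>
      Real.rpow_nonneg (ih _ fun i => ha _) _) _

lemma mixedSum_const_mul {t : Fin m → ℝ} (ht : ∀ k, 0 < t k) {a : (Fin m → Fin n) → ℝ}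
    (ha : ∀ j, 0 ≤ a j) {c : ℝ} (hc : 0 ≤ c) :
    mixedSum t (fun j => c * a j) = c * mixedSum t a := by
  induction m with
  | zero => rfl
  | succ m ih =>
    have h0 := ht 0
    have hN : ∀ l, 0 ≤ mixedSum (Fin.tail t) (fun i => a (Fin.cons l i)) := fun l =>
      mixedSum_nonneg _ fun i => ha _
    rw [mixedSum_succ, mixedSum_succ]
    have : ∀ l, mixedSum (Fin.tail t) (fun i => c * a (Fin.cons l i)) =
        c * mixedSum (Fin.tail t) (fun i => a (Fin.cons l i)) := fun l =>
      ih (fun k => ht k.succ) (fun i => ha _)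
    simp only [this, Real.mul_rpow hc (hN _)]
    rw [← Finset.mul_sum, Real.mul_rpow (Real.rpow_nonneg hc _)
      (Finset.sum_nonneg fun l _ => Real.rpow_nonneg (hN l) _), ← Real.rpow_mul hc,
      mul_one_div_cancel h0.ne', Real.rpow_one]

lemma mixedSum_two {t : Fin m → ℝ} (ht : ∀ k, t k = 2) {a : (Fin m → Fin n) → ℝ}
    (ha : ∀ j, 0 ≤ a j) : mixedSum t a = √(∑ j, a j ^ 2) := by
  induction m with
  | zero =>
    have : ∀ j : Fin 0 → Fin n, a j = a Fin.elim0 := fun j => congrArg a (Subsingleton.elim _ _)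
    simp [mixedSum_zero, Real.sqrt_sq (ha _), this]
  | succ m ih =>
    rw [mixedSum_succ, ht 0, ← Real.sqrt_eq_rpow, sum_fin_succ_pi]
    congr 1
    refine Finset.sum_congr rfl fun l _ => ?_
    rw [ih (t := Fin.tail t) (fun k => ht k.succ) (fun i => ha _), Real.rpow_two, Real.sq_sqrt (by positivity)]

/-- Superadditivity of `x ^ p` on the left and midpoint convexity on the right. This lets a
two-point inequality pass from one exponent to any larger one. -/
lemma two_mul_rpow_add_rpow_le {A B X Y p : ℝ} (hA : 0 ≤ A) (hB : 0 ≤ B) (hX : 0 ≤ X) (hY : 0 ≤ Y)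
    (hp : 1 ≤ p) (h : 2 * (X + Y) ≤ A + B) : 2 * (X ^ p + Y ^ p) ≤ A ^ p + B ^ p := by
  have h1 := (convexOn_rpow hp).2 (Set.mem_Ici.2 hA) (Set.mem_Ici.2 hB)
    (by norm_num : (0 : ℝ) ≤ 1 / 2) (by norm_num : (0 : ℝ) ≤ 1 / 2) (by norm_num)
  simp only [smul_eq_mul] at h1
  have h2 : X ^ p + Y ^ p ≤ (X + Y) ^ p := by
    lift X to NNReal using hX
    lift Y to NNReal using hY
    exact_mod_cast NNReal.add_rpow_le_rpow_add X Y hp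
  have h3 : (X + Y) ^ p ≤ (1 / 2 * A + 1 / 2 * B) ^ p := by
    exact Real.rpow_le_rpow (by positivity) (by linarith) (by linarith)
  linarith

/-- Two-point cotype inequality with constant one for iterated `ℓ_t`-norms. -/
lemma mixedSum_two_point {𝕜 : Type*} [RCLike 𝕜] {t : Fin m → ℝ} (ht : Antitone t)
    (h2 : ∀ k, 2 ≤ t k) {q : ℝ} (hq : 2 ≤ q) (htq : ∀ k, t k ≤ q) (x y : (Fin m → Fin n) → 𝕜) :
    2 * (mixedSum t (fun j => ‖x j‖) ^ q + mixedSum t (fun j => ‖y j‖) ^ q) ≤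
      mixedSum t (fun j => ‖x j + y j‖) ^ q + mixedSum t (fun j => ‖x j - y j‖) ^ q := by
  induction m generalizing q with
  | zero =>
    simp only [mixedSum_zero]
    have e : ∀ z : 𝕜, ‖z‖ ^ q = (‖z‖ ^ 2) ^ (q / 2) := by
      intro z
      rw [← Real.rpow_natCast, ← Real.rpow_mul (norm_nonneg z)]
      congr 1
      push_cast
      ring
    rw [e, e, e, e]
    refine two_mul_rpow_add_rpow_le (by positivity) (by positivity) (by positivity) (by positivity)
      (by linarith) ?_
    have := parallelogram_law_with_norm 𝕜 (x Fin.elim0) (y Fin.elim0)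
    linarith
  | succ m ih =>
    have h0 : 0 < t 0 := by linarith [h2 0]
    have hF : ∀ z : (Fin (m + 1) → Fin n) → 𝕜, 0 ≤ ∑ l, mixedSum (Fin.tail t)
        (fun i => ‖z (Fin.cons l i)‖) ^ t 0 := fun z => Finset.sum_nonneg fun l _ =>
      Real.rpow_nonneg (mixedSum_nonneg _ fun i => norm_nonneg _) _
    have e : ∀ z : (Fin (m + 1) → Fin n) → 𝕜, mixedSum t (fun j => ‖z j‖) ^ q =
        (∑ l, mixedSum (Fin.tail t) (fun i => ‖z (Fin.cons l i)‖) ^ t 0) ^ (q / t 0) := by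
      intro z
      rw [mixedSum_succ, ← Real.rpow_mul (hF z), one_div_mul_eq_div]
    rw [e x, e y, e fun j => x j + y j, e fun j => x j - y j]
    refine two_mul_rpow_add_rpow_le (hF fun j => x j + y j) (hF fun j => x j - y j) (hF x) (hF y)
      (by rw [le_div_iff₀ h0, one_mul]; exact htq 0) ?_
    rw [← Finset.sum_add_distrib, ← Finset.sum_add_distrib, Finset.mul_sum]
    refine Finset.sum_le_sum fun l _ => ?_
    have htail : Antitone (Fin.tail t) := fun a b hab => ht (Fin.succ_le_succ_iff.2 hab)
    have h0k : ∀ k, Fin.tail t k ≤ t 0 := fun k => ht (Fin.zero_le k.succ)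
    -- The slices are compared at exponent `t 0`, which dominates the inner exponents by
    -- monotonicity, so the inequalities add up over `l`.
    exact ih htail (fun k => h2 k.succ) (h2 0) h0k (fun i => x (Fin.cons l i))
      (fun i => y (Fin.cons l i))

/-- Cotype inequality with constant one for iterated `ℓ_t`-norms, with one choice of signs. -/
lemma exists_signs_mixedSum_ge {𝕜 : Type*} [RCLike 𝕜] {t : Fin m → ℝ} (ht : Antitone t)
    (h2 : ∀ k, 2 ≤ t k) {q : ℝ} (hq : 2 ≤ q) (htq : ∀ k, t k ≤ q) {J : Type*} [DecidableEq J]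
    (v : J → (Fin m → Fin n) → 𝕜) (s : Finset J) :
    ∃ ε : J → 𝕜, (∀ j, ε j = 1 ∨ ε j = -1) ∧ ∑ j ∈ s, mixedSum t (fun i => ‖v j i‖) ^ q ≤
      mixedSum t (fun i => ‖∑ j ∈ s, ε j * v j i‖) ^ q := by
  induction s using Finset.induction_on with
  | empty =>
    refine ⟨fun _ => 1, fun _ => Or.inl rfl, ?_⟩
    rw [Finset.sum_empty]
    exact Real.rpow_nonneg (mixedSum_nonneg _ fun i => norm_nonneg _) _
  | insert j₀ s hj ih =>
    obtain ⟨ε, hε, h⟩ := ih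
    have key := mixedSum_two_point ht h2 hq htq (fun i => ∑ j ∈ s, ε j * v j i) (v j₀)
    have hsum : ∀ (η : 𝕜) i, ∑ j ∈ insert j₀ s, Function.update ε j₀ η j * v j i
        = ∑ j ∈ s, ε j * v j i + η * v j₀ i := by
      intro η i
      rw [Finset.sum_insert hj, add_comm, Function.update_self]
      congr 1
      refine Finset.sum_congr rfl fun j hj' => ?_
      rw [Function.update_of_ne (ne_of_mem_of_not_mem hj' hj)]
    have hsgn : ∀ η : 𝕜, (η = 1 ∨ η = -1) → ∀ j, Function.update ε j₀ η j = 1 ∨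
        Function.update ε j₀ η j = -1 := by
      intro η hη j
      by_cases hj : j = j₀
      · subst hj; simpa using hη
      · simpa [Function.update_of_ne hj] using hε j
    rcases le_total (∑ j ∈ insert j₀ s, mixedSum t (fun i => ‖v j i‖) ^ q)
      (mixedSum t (fun i => ‖∑ j ∈ s, ε j * v j i + v j₀ i‖) ^ q) with h' | h'
    · refine ⟨Function.update ε j₀ 1, hsgn 1 (Or.inl rfl), ?_⟩
      simpa only [hsum, one_mul] using h'
    · refine ⟨Function.update ε j₀ (-1), hsgn (-1) (Or.inr rfl), ?_⟩
      simp only [hsum, neg_mul, one_mul, ← sub_eq_add_neg]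
      rw [Finset.sum_insert hj] at h' ⊢
      linarith

end MixedSum

/-! ### The inequality for coefficient arrays -/

section UpperBound

variable {𝕜 : Type u} [RCLike 𝕜] {n m : ℕ}

/-- The form with coefficients `a` is bounded by `M` on the product of the unit balls of
`ℓ_{1/r_k}`. The vectors of such a ball are those with coordinates `u l * w l ^ r`, where `|u l| ≤ 1`
and `w` is a subprobability vector. -/
def FormBound (r : Fin m → ℝ) (a : (Fin m → Fin n) → 𝕜) (M : ℝ) : Prop :=
  ∀ (u : Fin m → Fin n → 𝕜) (w : Fin m → Fin n → ℝ), (∀ k l, ‖u k l‖ ≤ 1) →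
    (∀ k, IsSubprob (w k)) →
    ‖∑ j, a j * ∏ k, (u k (j k) * ((w k (j k) ^ r k : ℝ) : 𝕜))‖ ≤ M

lemma exists_norm_le_one_mul_eq_norm (z : 𝕜) : ∃ θ : 𝕜, ‖θ‖ ≤ 1 ∧ θ * z = (‖z‖ : 𝕜) := by
  rcases eq_or_ne z 0 with rfl | hz
  · exact ⟨0, by simp, by simp⟩
  · have hz' : (‖z‖ : 𝕜) ≠ 0 := by simpa using hz
    refine ⟨(starRingEnd 𝕜) z / ‖z‖, ?_, ?_⟩
    · rw [norm_div, RCLike.norm_conj, RCLike.norm_ofReal, abs_norm]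
      exact div_self_le_one _
    · rw [div_mul_eq_mul_div, RCLike.conj_mul, sq, mul_div_assoc, div_self hz', mul_one]

lemma norm_sign_le_one {ε : 𝕜} (h : ε = 1 ∨ ε = -1) : ‖ε‖ ≤ 1 := by
  rcases h with rfl | rfl <;> simp

/-- The mixed `(ℓ₁, ℓ₂)` inequality, with weights. -/
lemma FormBound.sum_sqrt_le {r : Fin m → ℝ} {a : (Fin m → Fin n) → 𝕜} (h : FormBound r a 1)
    {w : Fin m → Fin n → ℝ} (hw : ∀ k, IsSubprob (w k)) (i : Fin m) :
    ∑ l, √(∑ j with j i = l, ‖a j‖ ^ 2 * ∏ k, w k (j k) ^ (2 * r k)) ≤ (16 / 9) ^ m := by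
  -- One family of signs serves all slices `j i = l`. The phases `θ l` inserted in variable `i` then
  -- turn `∑ ‖b l‖` into a single value of the form.
  obtain ⟨ε, hε, h1⟩ := exists_multi_signs_sum_norm_ge (𝕜 := 𝕜) m (H := 𝕜)
    (fun (l : Fin n) j => if j i = l then a j * ∏ k, ((w k (j k) ^ r k : ℝ) : 𝕜) else 0)
  have e1 : ∀ l : Fin n,
      ∑ j, ‖(if j i = l then a j * ∏ k, ((w k (j k) ^ r k : ℝ) : 𝕜) else 0 : 𝕜)‖ ^ 2 =
      ∑ j with j i = l, ‖a j‖ ^ 2 * ∏ k, w k (j k) ^ (2 * r k) := by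
    intro l
    rw [Finset.sum_filter]
    refine Finset.sum_congr rfl fun j _ => ?_
    split_ifs with hj
    · rw [norm_mul, mul_pow, norm_prod, ← Finset.prod_pow]
      congr 1
      refine Finset.prod_congr rfl fun k _ => ?_
      have hwk := (hw k).1 (j k)
      rw [RCLike.norm_ofReal, abs_of_nonneg (Real.rpow_nonneg hwk _), ← Real.rpow_natCast,
        ← Real.rpow_mul hwk, mul_comm]
      norm_num
    · simp
  simp only [e1] at h1
  set b : Fin n → 𝕜 := fun l => ∑ j, (∏ k, ε k (j k)) •
    (if j i = l then a j * ∏ k, ((w k (j k) ^ r k : ℝ) : 𝕜) else 0 : 𝕜) with hb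
  choose θ hθ hθb using fun l => exists_norm_le_one_mul_eq_norm (b l)
  have h2 : ∑ l, ‖b l‖ ≤ 1 := by
    have h3 := h (fun k l => (if k = i then θ l else 1) * ε k l) w (fun k l => ?_) hw
    · have e2 : ∑ j, a j * ∏ k, ((if k = i then θ (j k) else 1) * ε k (j k) *
          ((w k (j k) ^ r k : ℝ) : 𝕜)) = ((∑ l, ‖b l‖ : ℝ) : 𝕜) := by
        push_cast
        simp only [← hθb]
        simp only [hb, Finset.mul_sum]
        rw [Finset.sum_comm]
        refine Finset.sum_congr rfl fun j _ => ?_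
        simp only [mul_ite, mul_zero, Finset.sum_ite_eq, Finset.mem_univ,
          if_true, Finset.prod_mul_distrib, Finset.prod_ite_eq', smul_eq_mul]
        ring
      rw [e2, RCLike.norm_ofReal] at h3
      exact (le_abs_self _).trans h3
    · rw [norm_mul]
      refine mul_le_one₀ ?_ (norm_nonneg _) (norm_sign_le_one (hε k l))
      split_ifs
      · exact hθ l
      · simp
  have h3 := h1.trans h2
  have e3 : (16 / 9 : ℝ) ^ m = 1 / (9 / 16) ^ m := by rw [one_div, ← inv_pow]; norm_num
  rw [e3, le_div_iff₀ (by positivity), mul_comm]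
  exact h3

lemma sum_filter_zero_eq {M : Type*} [AddCommMonoid M] (f : (Fin (m + 1) → Fin n) → M)
    (l : Fin n) : ∑ j with j 0 = l, f j = ∑ i, f (Fin.cons l i) := by
  rw [Finset.sum_filter, sum_fin_succ_pi, Finset.sum_comm]
  simp

/-- The case in which only the first exponent is larger than two. -/
lemma FormBound.mixedSum_le_of_tail_two {r : Fin (m + 1) → ℝ} (hr : ∀ k, 0 ≤ r k)
    (hr1 : ∑ k, r k < 1) (hr2 : ∑ k : Fin m, r k.succ ≤ 1 / 2) {a : (Fin (m + 1) → Fin n) → 𝕜}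
    (h : FormBound r a 1) {t : Fin (m + 1) → ℝ} (ht0 : t 0 = (1 - ∑ k, r k)⁻¹)
    (ht : ∀ k : Fin m, t k.succ = 2) :
    mixedSum t (fun j => ‖a j‖) ≤ (16 / 9) ^ (m + 1) := by
  set D : ℝ := (16 / 9) ^ (m + 1) with hD
  have hD0 : 0 < D := by positivity
  set σ := ∑ k : Fin m, r k.succ with hσ
  have hσ0 : 0 ≤ σ := Finset.sum_nonneg fun k _ => hr _
  have hsum : ∑ k, r k = r 0 + σ := Fin.sum_univ_succ r
  rw [hsum] at hr1 ht0
  have hr0 := hr 0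
  have hK : ∑ k ∈ Finset.univ.erase 0, r k = σ := by
    have := Finset.add_sum_erase Finset.univ r (Finset.mem_univ 0)
    linarith
  set α := 1 / (2 * (1 - σ)) with hα
  have h2σ : 0 < 2 * (1 - σ) := by linarith
  have hα0 : 0 < α := by positivity
  have hrα : 2 * r 0 * α < 1 := by
    rw [hα, mul_one_div, div_lt_one h2σ]; linarith
  set S : Fin n → ℝ := fun l => ∑ i, ‖a (Fin.cons l i)‖ ^ 2 with hS
  have hS0 : ∀ l, 0 ≤ S l := fun l => by positivity
  have hSD0 : ∀ l, 0 ≤ S l / D ^ 2 := fun l => div_nonneg (hS0 l) (by positivity)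
  -- The weight of the outermost variable is kept inside `c` while the others are removed; it is
  -- constant on the fibres of coordinate `0` and is removed last, by duality, so `r 0` need not fit
  -- under the bound `1/2`.
  have main : ∀ w, IsSubprob w → ∑ l, w l ^ (2 * r 0 * α) * (S l / D ^ 2) ^ α ≤ 1 := by
    intro w hw
    have h1 := sum_fiber_rpow_le_one_of_forall_weights hr (Finset.univ.erase 0) (by rw [hK]; exact hr2)
      (c := fun j : Fin (m + 1) → Fin n => w (j 0) ^ (2 * r 0) * (‖a j‖ ^ 2 / D ^ 2))
      (fun j => mul_nonneg (Real.rpow_nonneg (hw.1 _) _) (by positivity)) (fun w' hw' i => ?_) 0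
    · rw [hK] at h1
      refine le_trans (le_of_eq (Finset.sum_congr rfl fun l _ => ?_)) h1
      rw [sum_filter_zero_eq]
      simp only [Fin.cons_zero]
      rw [← Finset.mul_sum, ← Finset.sum_div, Real.mul_rpow (Real.rpow_nonneg (hw.1 l) _) (hSD0 l),
        ← Real.rpow_mul (hw.1 l)]
    · have h2 := h.sum_sqrt_le (w := Function.update w' 0 w) (fun k => ?_) i
      · rw [← div_le_one hD0, Finset.sum_div] at h2
        refine le_trans (le_of_eq (Finset.sum_congr rfl fun l _ => ?_)) h2
        rw [← Real.sqrt_eq_rpow, ← Real.sqrt_sq hD0.le, ← Real.sqrt_div' _ (by positivity),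
          Finset.sum_div, Real.sqrt_sq hD0.le]
        congr 1
        refine Finset.sum_congr rfl fun j _ => ?_
        rw [← Finset.mul_prod_erase Finset.univ _ (Finset.mem_univ 0), Function.update_self]
        have : ∏ k ∈ Finset.univ.erase 0, Function.update w' 0 w k (j k) ^ (2 * r k) =
            ∏ k ∈ Finset.univ.erase 0, w' k (j k) ^ (2 * r k) :=
          Finset.prod_congr rfl fun k hk => by
            rw [Function.update_of_ne (Finset.ne_of_mem_erase hk)]
        rw [this]
        ring
      · by_cases hk : k = 0
        · subst hk; simpa using hw
        · simpa [Function.update_of_ne hk] using hw' k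
  have h3 := sum_rpow_le_of_forall_subprob (fun l => Real.rpow_nonneg (hSD0 l) α) hrα main
  have hs0 : 0 < t 0 := by rw [ht0]; exact inv_pos.2 (by linarith)
  have e1 : α * (1 / (1 - 2 * r 0 * α)) = t 0 / 2 := by
    have h4 : 1 - σ ≠ 0 := by linarith
    have h5 : 1 - (r 0 + σ) ≠ 0 := by linarith
    have h6 : 1 - 2 * r 0 * α = (1 - (r 0 + σ)) / (1 - σ) := by rw [hα]; field_simp; ring
    rw [ht0, h6, hα]
    field_simp
  simp only [← Real.rpow_mul (hSD0 _), e1, Real.one_rpow] at h3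
  rw [mixedSum_succ]
  have e2 : ∀ l, mixedSum (Fin.tail t) (fun i => ‖a (Fin.cons l i)‖) ^ t 0 =
      D ^ t 0 * (S l / D ^ 2) ^ (t 0 / 2) := by
    intro l
    rw [mixedSum_two (t := Fin.tail t) ht fun i => norm_nonneg _, Real.div_rpow (hS0 l) (by positivity),
      ← Real.rpow_natCast D 2, ← Real.rpow_mul hD0.le, Real.sqrt_eq_rpow, ← Real.rpow_mul (hS0 l)]
    have e3 : ((2 : ℕ) : ℝ) * (t 0 / 2) = t 0 := by push_cast; ring
    rw [e3, one_div_mul_eq_div, mul_div_cancel₀ _ (by positivity)]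
  simp only [e2]
  rw [← Finset.mul_sum]
  calc _ ≤ (D ^ t 0 * 1) ^ (1 / t 0) := by gcongr
    _ = D := by rw [mul_one, ← Real.rpow_mul hD0.le, mul_one_div_cancel hs0.ne', Real.rpow_one]

/-- `r_k + ⋯ + r_m`. -/
def rTail (r : Fin m → ℝ) (k : Fin m) : ℝ := ∑ j ∈ Finset.Ici k, r j

/-- The exponents `s_k`, in terms of `r_k = 1 / p_k`. -/
noncomputable def rExponent (r : Fin m → ℝ) (k₀ k : Fin m) : ℝ := if k ≤ k₀ then (1 - rTail r k)⁻¹ else 2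

lemma rTail_zero (r : Fin (m + 1) → ℝ) : rTail r 0 = ∑ k, r k := by
  unfold rTail
  congr 1
  ext k
  simp

lemma rTail_succ (r : Fin (m + 1) → ℝ) (k : Fin m) : rTail r k.succ = rTail (Fin.tail r) k := by
  unfold rTail
  rw [← Fin.map_succEmb_Ici, Finset.sum_map]
  rfl

lemma rTail_anti {r : Fin m → ℝ} (hr : ∀ k, 0 ≤ r k) : Antitone (rTail r) := fun _ _ h =>
  Finset.sum_le_sum_of_subset_of_nonneg (Finset.Ici_subset_Ici.2 h) fun k _ _ => hr k

lemma rTail_le_sum {r : Fin m → ℝ} (hr : ∀ k, 0 ≤ r k) (k : Fin m) : rTail r k ≤ ∑ k, r k :=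
  Finset.sum_le_sum_of_subset_of_nonneg (Finset.subset_univ _) fun k _ _ => hr k

lemma rExponent_pos {r : Fin m → ℝ} (hr : ∀ k, 0 ≤ r k) (hr1 : ∑ k, r k < 1) (k₀ k : Fin m) :
    0 < rExponent r k₀ k := by
  unfold rExponent
  split_ifs
  · exact inv_pos.2 (by linarith [rTail_le_sum hr k])
  · norm_num

lemma two_le_rExponent {r : Fin m → ℝ} (hr : ∀ k, 0 ≤ r k) (hr1 : ∑ k, r k < 1) {k₀ : Fin m}
    (hk₀ : 1 / 2 ≤ rTail r k₀) (k : Fin m) : 2 ≤ rExponent r k₀ k := by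
  unfold rExponent
  split_ifs with h
  · have h1 := rTail_anti hr h
    have h2 := rTail_le_sum hr k
    rw [le_inv_comm₀ (by norm_num) (by linarith)]
    linarith
  · exact le_rfl

lemma rExponent_antitone {r : Fin m → ℝ} (hr : ∀ k, 0 ≤ r k) (hr1 : ∑ k, r k < 1) {k₀ : Fin m}
    (hk₀ : 1 / 2 ≤ rTail r k₀) : Antitone (rExponent r k₀) := by
  intro i k hik
  by_cases hk : k ≤ k₀
  · have h1 := rTail_anti hr hik
    have h2 := rTail_le_sum hr i
    simp only [rExponent, hk, hik.trans hk, if_true]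
    exact inv_anti₀ (by linarith) (by linarith)
  · have : rExponent r k₀ k = 2 := by simp [rExponent, hk]
    rw [this]
    exact two_le_rExponent hr hr1 hk₀ i

/-- One more variable, by the cotype inequality. -/
lemma mixedSum_le_of_forall_slice {r : Fin (m + 1) → ℝ} {a : (Fin (m + 1) → Fin n) → 𝕜}
    (h : FormBound r a 1) {t : Fin (m + 1) → ℝ} (ht : Antitone t) (h2 : ∀ k, 2 ≤ t k) {q C : ℝ}
    (hq : 2 ≤ q) (hC : 0 ≤ C)
    (htq : ∀ k : Fin m, t k.succ ≤ q) (hqt : 1 / t 0 = 1 / q - r 0)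
    (ih : ∀ a' : (Fin m → Fin n) → 𝕜, FormBound (Fin.tail r) a' 1 →
      mixedSum (Fin.tail t) (fun i => ‖a' i‖) ≤ C) :
    mixedSum t (fun j => ‖a j‖) ≤ C := by
  have h0 : 0 < t 0 := by linarith [h2 0]
  have hq0 : 0 < q := by linarith
  set N : Fin n → ℝ := fun l => mixedSum (Fin.tail t) (fun i => ‖a (Fin.cons l i)‖) with hN
  have hN0 : ∀ l, 0 ≤ N l := fun l => mixedSum_nonneg _ fun i => norm_nonneg _
  have main : ∀ w, IsSubprob w → ∑ l, w l ^ (r 0 * q) * N l ^ q ≤ C ^ q := by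
    intro w hw
    obtain ⟨ε, hε, h1⟩ := exists_signs_mixedSum_ge (t := Fin.tail t)
      (fun a b hab => ht (Fin.succ_le_succ_iff.2 hab)) (fun k => h2 k.succ) hq htq
      (fun l i => ((w l ^ r 0 : ℝ) : 𝕜) * a (Fin.cons l i)) Finset.univ
    have h3 : mixedSum (Fin.tail t)
        (fun i => ‖∑ l, ε l * (((w l ^ r 0 : ℝ) : 𝕜) * a (Fin.cons l i))‖) ≤ C := by
      -- Combining the slices with coefficients `ε l * w l ^ r 0` amounts to freezing the first
      -- vector at a point of its unit ball.
      refine ih _ fun u w' hu hw' => ?_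
      have h4 := h (Fin.cons ε u) (Fin.cons w w') (fun k => ?_) (fun k => ?_)
      · convert h4 using 2
        rw [sum_fin_succ_pi, Finset.sum_comm]
        refine Finset.sum_congr rfl fun i _ => ?_
        rw [Finset.sum_mul]
        refine Finset.sum_congr rfl fun l _ => ?_
        simp only [Fin.prod_univ_succ, Fin.cons_zero, Fin.cons_succ, Fin.tail]
        ring
      · refine Fin.cases ?_ (fun k => ?_) k
        · exact fun l => norm_sign_le_one (hε l)
        · exact hu k
      · refine Fin.cases ?_ (fun k => ?_) k
        · exact hw
        · exact hw' k
    have e : ∀ l, mixedSum (Fin.tail t) (fun i => ‖((w l ^ r 0 : ℝ) : 𝕜) * a (Fin.cons l i)‖) ^ q =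
        w l ^ (r 0 * q) * N l ^ q := by
      intro l
      have hwl := Real.rpow_nonneg (hw.1 l) (r 0)
      simp only [norm_mul, RCLike.norm_ofReal, abs_of_nonneg hwl]
      rw [mixedSum_const_mul (fun k => by linarith [h2 k.succ, show Fin.tail t k = t k.succ from rfl])
        (fun i => norm_nonneg _) hwl, Real.mul_rpow hwl (hN0 l), ← Real.rpow_mul (hw.1 l)]
    simp only [e] at h1
    refine h1.trans ?_
    have := mixedSum_nonneg (Fin.tail t)
      (fun i => norm_nonneg (∑ l, ε l * (((w l ^ r 0 : ℝ) : 𝕜) * a (Fin.cons l i))))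
    gcongr
  have ht0' : 1 / t 0 * q = 1 - r 0 * q := by rw [hqt]; field_simp
  have hpos : 0 < 1 / t 0 * q := by positivity
  have h3 := sum_rpow_le_of_forall_subprob (fun l => Real.rpow_nonneg (hN0 l) q)
    (by linarith) main
  have e : q * (1 / (1 - r 0 * q)) = t 0 := by rw [← ht0']; field_simp
  simp only [← Real.rpow_mul (hN0 _), ← Real.rpow_mul hC, e] at h3
  rw [mixedSum_succ]
  calc _ ≤ (C ^ t 0) ^ (1 / t 0) := by
        have : 0 ≤ ∑ l, N l ^ t 0 := Finset.sum_nonneg fun l _ => Real.rpow_nonneg (hN0 l) _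
        gcongr
    _ = C := by rw [← Real.rpow_mul hC, mul_one_div_cancel h0.ne', Real.rpow_one]

/-- The Hardy–Littlewood inequality, for arrays. -/
theorem FormBound.mixedSum_rExponent_le {r : Fin m → ℝ} (hr : ∀ k, 0 ≤ r k) (hr1 : ∑ k, r k < 1)
    {k₀ : Fin m} (hk₀ : IsGreatest {k | 1 / 2 ≤ rTail r k} k₀) {a : (Fin m → Fin n) → 𝕜}
    (h : FormBound r a 1) : mixedSum (rExponent r k₀) (fun j => ‖a j‖) ≤ (16 / 9) ^ m := by
  induction m with
  | zero => exact k₀.elim0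
  | succ m ih =>
    have hsum : ∑ k, r k = r 0 + ∑ k : Fin m, r k.succ := Fin.sum_univ_succ r
    have hr0 := hr 0
    induction k₀ using Fin.cases with
    | zero =>
      refine h.mixedSum_le_of_tail_two hr hr1 ?_ ?_ fun k => ?_
      · cases m with
        | zero => simp
        | succ m =>
          -- Maximality of `k₀ = 0` forces the tail from the next index on to be at most `1/2`.
          by_contra! hlt
          have : (Fin.succ 0 : Fin (m + 2)) ≤ 0 := hk₀.2 (by
            simp only [Set.mem_ofPred_eq]
            rw [rTail_succ, rTail_zero]
            exact hlt.le)
          simp at this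
      · simp [rExponent, rTail_zero]
      · simp [rExponent]
    | succ k₀ =>
      have hk₀' : IsGreatest {k | 1 / 2 ≤ rTail (Fin.tail r) k} k₀ := by
        refine ⟨?_, fun k hk => ?_⟩
        · simpa only [Set.mem_ofPred_eq, rTail_succ] using hk₀.1
        · refine Fin.succ_le_succ_iff.1 (hk₀.2 ?_)
          simpa only [Set.mem_ofPred_eq, rTail_succ] using hk
      have htail : Fin.tail (rExponent r k₀.succ) = rExponent (Fin.tail r) k₀ := by
        ext k
        simp [Fin.tail, rExponent, rTail_succ]
      have hm : 0 < m := Fin.pos k₀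
      have hr1' : ∑ k, Fin.tail r k < 1 := by
        have : ∑ k, Fin.tail r k = ∑ k : Fin m, r k.succ := rfl
        linarith
      have hanti := rExponent_antitone hr hr1 hk₀.1
      have hanti' := rExponent_antitone (fun k => hr k.succ) hr1' hk₀'.1
      refine (mixedSum_le_of_forall_slice (C := (16 / 9) ^ m)
        (q := rExponent (Fin.tail r) k₀ ⟨0, hm⟩) h hanti (two_le_rExponent hr hr1 hk₀.1)
        (two_le_rExponent (fun k => hr k.succ) hr1' hk₀'.1 _) (by positivity) (fun k => ?_) ?_
        (fun a' ha' => ?_)).trans ?_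
      · rw [show rExponent r k₀.succ k.succ = rExponent (Fin.tail r) k₀ k from congrFun htail k]
        exact hanti' (Fin.mk_le_of_le_val (Nat.zero_le _))
      · obtain ⟨m, rfl⟩ := Nat.exists_eq_succ_of_ne_zero hm.ne'
        have e1 : rExponent r k₀.succ 0 = (1 - ∑ k, r k)⁻¹ := by simp [rExponent, rTail_zero]
        have e2 : rExponent (Fin.tail r) k₀ ⟨0, hm⟩ = (1 - ∑ k, Fin.tail r k)⁻¹ := by
          rw [← rTail_zero]
          simp only [rExponent]
          exact if_pos (Fin.zero_le _)
        rw [e1, e2, one_div, one_div, inv_inv, inv_inv, hsum]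
        simp only [Fin.tail]
        ring
      · rw [htail]
        exact ih (fun k => hr k.succ) hr1' hk₀' ha'
      · exact pow_le_pow_right₀ (by norm_num) (Nat.le_succ m)

end UpperBound

/-! ### Multilinear forms versus coefficient arrays -/

section Transfer

variable {𝕜 : Type*} [RCLike 𝕜] {m n : ℕ}

lemma FormBound.const_mul {r : Fin m → ℝ} {a : (Fin m → Fin n) → 𝕜} {M : ℝ} (h : FormBound r a M)
    {c : ℝ} (hc : 0 ≤ c) : FormBound r (fun j => (c : 𝕜) * a j) (c * M) := by
  intro u w hu hw
  simp only [mul_assoc]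
  rw [← Finset.mul_sum, norm_mul, RCLike.norm_ofReal, abs_of_nonneg hc]
  exact mul_le_mul_of_nonneg_left (h u w hu hw) hc

variable (𝕜) in
/-- The Hardy–Littlewood inequality with exponents `t` and constant `C` on the product of the spaces
`ℓ_{1/r_k}^n`, in terms of coefficient arrays. -/
def ArrayHL (r t : Fin m → ℝ) (C : ℝ) : Prop :=
  ∀ n : ℕ, 0 < n → ∀ a : (Fin m → Fin n) → 𝕜, FormBound r a 1 → mixedSum t (fun j => ‖a j‖) ≤ C

lemma ArrayHL.mixedSum_le {r t : Fin m → ℝ} {C : ℝ} (h : ArrayHL 𝕜 r t C) (ht : ∀ k, 0 < t k)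
    (hn : 0 < n) {a : (Fin m → Fin n) → 𝕜} {M : ℝ} (hM : 0 < M) (ha : FormBound r a M) :
    mixedSum t (fun j => ‖a j‖) ≤ C * M := by
  have h1 := h n hn _ (inv_mul_cancel₀ hM.ne' ▸ ha.const_mul (inv_nonneg.2 hM.le))
  simp only [norm_mul, RCLike.norm_ofReal, abs_of_nonneg (inv_nonneg.2 hM.le)] at h1
  rw [mixedSum_const_mul ht (fun j => norm_nonneg _) (inv_nonneg.2 hM.le), inv_mul_le_iff₀ hM,
    mul_comm] at h1
  exact h1

lemma norm_toLp_mul_rpow_le_one {q : ℝ≥0∞} [hq : Fact (1 ≤ q)] {u : Fin n → 𝕜} {w : Fin n → ℝ}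
    (hu : ∀ l, ‖u l‖ ≤ 1) (hw : IsSubprob w) :
    ‖(WithLp.toLp q fun l => u l * ((w l ^ (q⁻¹).toReal : ℝ) : 𝕜) : ell 𝕜 q n)‖ ≤ 1 := by
  rcases eq_or_ne q ∞ with rfl | hq'
  · rw [PiLp.norm_eq_ciSup]
    refine Real.iSup_le (fun l => ?_) zero_le_one
    simpa using hu l
  · have hq0 : 0 < q.toReal := ENNReal.toReal_pos (zero_lt_one.trans_le hq.out).ne' hq'
    rw [PiLp.norm_eq_sum hq0]
    refine Real.rpow_le_one (by positivity) ?_ (by positivity)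
    refine le_trans (Finset.sum_le_sum fun l _ => ?_) hw.2
    have hwl := Real.rpow_nonneg (hw.1 l) (q⁻¹).toReal
    rw [PiLp.toLp_apply, norm_mul, RCLike.norm_ofReal, abs_of_nonneg hwl]
    calc (‖u l‖ * w l ^ (q⁻¹).toReal) ^ q.toReal ≤ (1 * w l ^ (q⁻¹).toReal) ^ q.toReal := by
          gcongr
          exact hu l
      _ = w l := by
          rw [one_mul, ENNReal.toReal_inv, ← Real.rpow_mul (hw.1 l), inv_mul_cancel₀ hq0.ne',
            Real.rpow_one]

lemma exists_eq_norm_mul_rpow {q : ℝ≥0∞} [hq : Fact (1 ≤ q)] (x : ell 𝕜 q n) :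
    ∃ (u : Fin n → 𝕜) (w : Fin n → ℝ), (∀ l, ‖u l‖ ≤ 1) ∧ IsSubprob w ∧
      ∀ l, x l = (‖x‖ : 𝕜) * (u l * ((w l ^ (q⁻¹).toReal : ℝ) : 𝕜)) := by
  rcases eq_or_ne x 0 with rfl | hx
  · exact ⟨fun _ => 0, fun _ => 0, by simp, isSubprob_zero, by simp⟩
  have hx0 : 0 < ‖x‖ := norm_pos_iff.2 hx
  have hx0' : (‖x‖ : 𝕜) ≠ 0 := by exact_mod_cast hx0.ne'
  rcases eq_or_ne q ∞ with rfl | hq'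
  -- For `q = ∞` the exponent is `0` and `0 ^ 0 = 1`, so the zero weight imposes nothing.
  · refine ⟨fun l => x l / ‖x‖, fun _ => 0, fun l => ?_, isSubprob_zero, fun l => ?_⟩
    · rw [norm_div, RCLike.norm_ofReal, abs_norm, div_le_one hx0]
      exact PiLp.norm_apply_le x l
    · simp only [ENNReal.inv_top, ENNReal.toReal_zero, Real.rpow_zero, RCLike.ofReal_one, mul_one]
      rw [mul_div_cancel₀ _ hx0']
  · have hq0 : 0 < q.toReal := ENNReal.toReal_pos (zero_lt_one.trans_le hq.out).ne' hq'
    refine ⟨fun l => x l / ‖x l‖, fun l => (‖x l‖ / ‖x‖) ^ q.toReal, fun l => ?_,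
      ⟨fun l => by positivity, ?_⟩, fun l => ?_⟩
    · rw [norm_div, RCLike.norm_ofReal, abs_norm]
      exact div_self_le_one _
    · have h1 : ‖x‖ ^ q.toReal = ∑ l, ‖x l‖ ^ q.toReal := by
        rw [PiLp.norm_eq_sum hq0, ← Real.rpow_mul (by positivity), one_div_mul_cancel hq0.ne',
          Real.rpow_one]
      have h2 : ∀ l, (‖x l‖ / ‖x‖) ^ q.toReal = ‖x l‖ ^ q.toReal / ‖x‖ ^ q.toReal := fun l =>
        Real.div_rpow (norm_nonneg _) hx0.le _
      simp only [h2]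
      rw [← Finset.sum_div, h1]
      exact div_self_le_one _
    · rw [ENNReal.toReal_inv, ← Real.rpow_mul (by positivity), mul_inv_cancel₀ hq0.ne',
        Real.rpow_one]
      rcases eq_or_ne (x l) 0 with h | h
      · simp [h]
      · have : (‖x l‖ : 𝕜) ≠ 0 := by simpa using h
        push_cast
        field_simp

/-- The form with a given array of coefficients. -/
noncomputable def formOfArray (p : Fin m → ℝ≥0∞) [∀ k, Fact (1 ≤ p k)]
    (a : (Fin m → Fin n) → 𝕜) : ContinuousMultilinearMap 𝕜 (fun k => ell 𝕜 (p k) n) 𝕜 :=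
  ∑ j, a j • (ContinuousMultilinearMap.mkPiAlgebra 𝕜 (Fin m) 𝕜).compContinuousLinearMap
    fun k => PiLp.proj (p k) (fun _ => 𝕜) (j k)

lemma formOfArray_apply (p : Fin m → ℝ≥0∞) [∀ k, Fact (1 ≤ p k)] (a : (Fin m → Fin n) → 𝕜)
    (x : ∀ k, ell 𝕜 (p k) n) : formOfArray p a x = ∑ j, a j * ∏ k, x k (j k) := by
  simp [formOfArray]

lemma formOfArray_single (p : Fin m → ℝ≥0∞) [∀ k, Fact (1 ≤ p k)] (a : (Fin m → Fin n) → 𝕜)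
    (j : Fin m → Fin n) : formOfArray p a (fun k => PiLp.single (p k) (j k) (1 : 𝕜)) = a j := by
  rw [formOfArray_apply, Finset.sum_eq_single j]
  · simp
  · intro i _ hij
    obtain ⟨k, hk⟩ := Function.ne_iff.1 hij
    rw [Finset.prod_eq_zero (Finset.mem_univ k), mul_zero]
    simp [hk]
  · simp

lemma norm_formOfArray_le {p : Fin m → ℝ≥0∞} [∀ k, Fact (1 ≤ p k)] {a : (Fin m → Fin n) → 𝕜}
    {M : ℝ} (hM : 0 ≤ M) (h : FormBound (fun k => ((p k)⁻¹).toReal) a M) :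
    ‖formOfArray p a‖ ≤ M := by
  refine ContinuousMultilinearMap.opNorm_le_bound hM fun x => ?_
  choose u w hu hw hx using fun k => exists_eq_norm_mul_rpow (x k)
  rw [formOfArray_apply]
  have : ∑ j, a j * ∏ k, x k (j k) = (∏ k, (‖x k‖ : 𝕜)) *
      ∑ j, a j * ∏ k, (u k (j k) * ((w k (j k) ^ ((p k)⁻¹).toReal : ℝ) : 𝕜)) := by
    rw [Finset.mul_sum]
    refine Finset.sum_congr rfl fun j _ => ?_
    rw [Finset.prod_congr rfl fun k _ => hx k (j k), Finset.prod_mul_distrib]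
    ring
  rw [this, norm_mul, norm_prod, mul_comm]
  simp only [RCLike.norm_ofReal, abs_norm]
  exact mul_le_mul_of_nonneg_right (h u w hu hw) (by positivity)

lemma formBound_of_form {p : Fin m → ℝ≥0∞} [∀ k, Fact (1 ≤ p k)]
    (A : ContinuousMultilinearMap 𝕜 (fun k => ell 𝕜 (p k) n) 𝕜) :
    FormBound (fun k => ((p k)⁻¹).toReal)
      (fun j => A fun k => PiLp.single (p k) (j k) (1 : 𝕜)) ‖A‖ := by
  intro u w hu hw
  set z : ∀ k, ell 𝕜 (p k) n := fun k =>
    WithLp.toLp (p k) fun l => u k l * ((w k l ^ ((p k)⁻¹).toReal : ℝ) : 𝕜) with hz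
  have h1 : ∀ k, z k = ∑ l, z k l • PiLp.single (p k) l (1 : 𝕜) := by
    intro k
    ext l
    simp [Pi.single_apply]
  have h2 : A z = ∑ j : Fin m → Fin n, (A fun k => PiLp.single (p k) (j k) (1 : 𝕜)) * ∏ k, z k (j k) := by
    conv_lhs => rw [show z = fun k => ∑ l, z k l • PiLp.single (p k) l (1 : 𝕜) from funext h1]
    rw [A.map_sum]
    refine Finset.sum_congr rfl fun j _ => ?_
    rw [A.map_smul_univ, smul_eq_mul, mul_comm]
  have h3 : ‖A z‖ ≤ ‖A‖ := by
    refine (A.le_opNorm z).trans (mul_le_of_le_one_right (norm_nonneg _) ?_)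
    exact Finset.prod_le_one (fun k _ => norm_nonneg _) fun k _ =>
      norm_toLp_mul_rpow_le_one (hu k) (hw k)
  rw [h2] at h3
  exact h3

lemma ArrayHL.hlInequality {p : Fin m → ℝ≥0∞} [∀ k, Fact (1 ≤ p k)] {t : Fin m → ℝ} {C : ℝ}
    (ht : ∀ k, 0 < t k) (h : ArrayHL 𝕜 (fun k => ((p k)⁻¹).toReal) t C) : HLInequality 𝕜 p t C := by
  intro n hn A
  rcases (norm_nonneg A).eq_or_lt with h0 | h0
  · have hA : A = 0 := norm_eq_zero.1 h0.symm
    have := mixedSum_const_mul ht (a := fun _ : Fin m → Fin n => (0 : ℝ)) (fun _ => le_rfl)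
      (c := 0) le_rfl
    simp only [mul_zero, zero_mul] at this
    simp [hA, this]
  · exact h.mixedSum_le ht hn h0 (formBound_of_form A)

lemma HLInequality.arrayHL {p : Fin m → ℝ≥0∞} [∀ k, Fact (1 ≤ p k)] {t : Fin m → ℝ} {C : ℝ}
    (h : HLInequality 𝕜 p t C) : ArrayHL 𝕜 (fun k => ((p k)⁻¹).toReal) t |C| := by
  intro n hn a ha
  have h1 := h n hn (formOfArray p a)
  simp only [formOfArray_single] at h1
  calc _ ≤ C * ‖formOfArray p a‖ := h1
    _ ≤ |C| * ‖formOfArray p a‖ := by gcongr; exact le_abs_self C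
    _ ≤ |C| * 1 := by gcongr; exact norm_formOfArray_le zero_le_one ha
    _ = |C| := mul_one _

end Transfer

/-! ### Necessary conditions from diagonal forms -/

section LowerBound

variable {𝕜 : Type*} [RCLike 𝕜] {m n : ℕ}

lemma mixedSum_of_eq_zero {t : Fin m → ℝ} (ht : ∀ k, 0 < t k) :
    mixedSum t (fun _ : Fin m → Fin n => (0 : ℝ)) = 0 := by
  have := mixedSum_const_mul ht (a := fun _ : Fin m → Fin n => (0 : ℝ)) (fun _ => le_rfl)
    (c := 0) le_rfl
  simpa using this

/-- The iterated sum of an array supported on `j₁ = l₀`. -/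
lemma mixedSum_of_support {t : Fin (m + 1) → ℝ} (ht : ∀ k, 0 < t k) (l₀ : Fin n)
    {a : (Fin (m + 1) → Fin n) → ℝ} (ha : ∀ j, 0 ≤ a j) (h : ∀ l ≠ l₀, ∀ i, a (Fin.cons l i) = 0) :
    mixedSum t a = mixedSum (Fin.tail t) fun i => a (Fin.cons l₀ i) := by
  rw [mixedSum_succ, Finset.sum_eq_single l₀]
  · rw [← Real.rpow_mul (mixedSum_nonneg _ fun i => ha _), mul_one_div_cancel (ht 0).ne',
      Real.rpow_one]
  · intro l _ hl
    simp only [h l hl]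
    rw [mixedSum_of_eq_zero (t := Fin.tail t) fun k => ht k.succ, Real.zero_rpow (ht 0).ne']
  · simp

lemma mixedSum_indicator {t : Fin m → ℝ} (ht : ∀ k, 0 < t k) (c : Fin m → Fin n) :
    mixedSum t (fun j => if j = c then 1 else 0) = 1 := by
  induction m with
  | zero => simp [mixedSum_zero, Subsingleton.elim Fin.elim0 c]
  | succ m ih =>
    rw [mixedSum_of_support ht (c 0) (fun j => by split_ifs <;> norm_num)]
    · have hc : ∀ i : Fin m → Fin n, (Fin.cons (c 0) i : Fin (m + 1) → Fin n) = c ↔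
          i = Fin.tail c := fun i =>
        ⟨fun h => by rw [← h, Fin.tail_cons], fun h => by rw [h, Fin.cons_self_tail]⟩
      simp only [hc]
      exact ih (t := Fin.tail t) (fun k => ht k.succ) (Fin.tail c)
    · intro l hl i
      rw [if_neg]
      rintro rfl
      simp at hl

lemma mixedSum_one {t : Fin m → ℝ} (ht : ∀ k, 0 < t k) :
    mixedSum t (fun _ : Fin m → Fin n => (1 : ℝ)) = ∏ k, (n : ℝ) ^ (1 / t k) := by
  induction m with
  | zero => simp [mixedSum_zero]
  | succ m ih =>
    have hnn : 0 ≤ ∏ k : Fin m, (n : ℝ) ^ (1 / t k.succ) := by positivity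
    rw [mixedSum_succ, ih (t := Fin.tail t) fun k => ht k.succ, Finset.sum_const, Finset.card_univ,
      Fintype.card_fin, nsmul_eq_mul, Fin.prod_univ_succ,
      Real.mul_rpow (by positivity) (by simp only [Fin.tail]; positivity)]
    simp only [Fin.tail]
    rw [← Real.rpow_mul hnn, mul_one_div_cancel (ht 0).ne', Real.rpow_one]

/-- Restriction to the last variables. -/
lemma ArrayHL.tail {r t : Fin (m + 1) → ℝ} {C : ℝ} (hr : 0 ≤ r 0) (ht : ∀ k, 0 < t k)
    (h : ArrayHL 𝕜 r t C) : ArrayHL 𝕜 (Fin.tail r) (Fin.tail t) C := by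
  intro n hn a ha
  set l₀ : Fin n := ⟨0, hn⟩
  have h1 := h n hn (fun j => if j 0 = l₀ then a (Fin.tail j) else 0) (fun u w hu hw => ?_)
  · rw [mixedSum_of_support ht l₀ (fun j => norm_nonneg _) (fun l hl i => by simp [hl])] at h1
    simpa using h1
  · have e : ∑ j : Fin (m + 1) → Fin n, (if j 0 = l₀ then a (Fin.tail j) else 0) *
        ∏ k, (u k (j k) * ((w k (j k) ^ r k : ℝ) : 𝕜)) = (u 0 l₀ * ((w 0 l₀ ^ r 0 : ℝ) : 𝕜)) *
        ∑ i, a i * ∏ k, (u (Fin.succ k) (i k) *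
          ((w (Fin.succ k) (i k) ^ Fin.tail r k : ℝ) : 𝕜)) := by
      rw [sum_fin_succ_pi, Finset.sum_eq_single l₀]
      · rw [Finset.mul_sum]
        refine Finset.sum_congr rfl fun i _ => ?_
        simp only [Fin.cons_zero, if_true, Fin.tail_cons, Fin.prod_univ_succ, Fin.cons_succ,
          Fin.tail]
        ring
      · intro l _ hl
        simp [hl]
      · simp
    rw [e, norm_mul]
    refine mul_le_one₀ ?_ (norm_nonneg _) (ha _ _ (fun k => hu k.succ) fun k => hw k.succ)
    have hw0 := (hw 0).1
    have hw1 : w 0 l₀ ≤ 1 :=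
      (Finset.single_le_sum (fun l _ => hw0 l) (Finset.mem_univ l₀)).trans (hw 0).2
    rw [norm_mul, RCLike.norm_ofReal, abs_of_nonneg (Real.rpow_nonneg (hw0 _) _)]
    exact mul_le_one₀ (hu 0 l₀) (Real.rpow_nonneg (hw0 _) _) (Real.rpow_le_one (hw0 _) hw1 hr)

lemma le_of_forall_natCast_rpow_le {x y C : ℝ}
    (h : ∀ n : ℕ, 0 < n → (n : ℝ) ^ x ≤ C * (n : ℝ) ^ y) : x ≤ y := by
  by_contra! hlt
  have h1 : Filter.Tendsto (fun n : ℕ => (n : ℝ) ^ (x - y)) Filter.atTop Filter.atTop :=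
    (tendsto_rpow_atTop (by linarith)).comp tendsto_natCast_atTop_atTop
  obtain ⟨n, hn, hn0⟩ := ((h1.eventually_gt_atTop C).and (Filter.eventually_gt_atTop 0)).exists
  have hn0' : (0 : ℝ) < n := by exact_mod_cast hn0
  have h2 := h n hn0
  rw [Real.rpow_sub hn0', lt_div_iff₀ (by positivity)] at hn
  linarith

/-- Hölder's inequality for several vectors. -/
lemma sum_prod_rpow_le {r : Fin m → ℝ} (hr : ∀ k, 0 ≤ r k) (hr1 : ∑ k, r k ≤ 1) (hn : 0 < n)
    {w : Fin m → Fin n → ℝ} (hw : ∀ k, IsSubprob (w k)) :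
    ∑ l, ∏ k, w k l ^ r k ≤ (n : ℝ) ^ (1 - ∑ k, r k) := by
  have hn' : (0 : ℝ) < n := by exact_mod_cast hn
  set σ := ∑ k, r k with hσ
  have h1 : ∀ l, (∏ k, w k l ^ r k) * ((n : ℝ)⁻¹) ^ (1 - σ) ≤
      ∑ k, r k * w k l + (1 - σ) * (n : ℝ)⁻¹ := by
    intro l
    -- The missing mass `1 - σ` is placed on an extra constant weight `1/n`, indexed by `none`.
    have := Real.geom_mean_le_arith_mean_weighted Finset.univ
      (fun o : Option (Fin m) => o.elim (1 - σ) r)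
      (fun o : Option (Fin m) => o.elim (n : ℝ)⁻¹ fun k => w k l)
      (fun o _ => by cases o <;> simp [hr]; linarith) (by simp [Fintype.sum_option]; linarith)
      (fun o _ => by
        cases o
        · exact inv_nonneg.2 hn'.le
        · exact (hw _).1 l)
    simp only [Fintype.prod_option, Fintype.sum_option, Option.elim] at this
    linarith
  have h2 : (∑ l, ∏ k, w k l ^ r k) * ((n : ℝ)⁻¹) ^ (1 - σ) ≤ 1 := by
    rw [Finset.sum_mul]
    refine (Finset.sum_le_sum fun l _ => h1 l).trans ?_
    rw [Finset.sum_add_distrib, Finset.sum_comm, Finset.sum_const, Finset.card_univ,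
      Fintype.card_fin, nsmul_eq_mul]
    have h3 : ∑ k, ∑ l, r k * w k l ≤ σ := by
      refine Finset.sum_le_sum fun k _ => ?_
      rw [← Finset.mul_sum]
      exact mul_le_of_le_one_right (hr k) (hw k).2
    have h4 : (n : ℝ) * ((1 - σ) * (n : ℝ)⁻¹) = 1 - σ := by field_simp
    linarith
  rwa [Real.inv_rpow hn'.le, ← div_eq_mul_inv, div_le_one (by positivity)] at h2

/-- The diagonal form `∑ l, ∏ k, x k l` has norm at most `n ^ (1 - ∑ r k)` by Hölder. Each of its
slices has one nonzero entry, so its iterated sum is `n ^ (1 / t 0)`, whatever the inner exponents.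
-/
lemma ArrayHL.one_div_zero_le {r t : Fin (m + 1) → ℝ} {C : ℝ} (hr : ∀ k, 0 ≤ r k)
    (hr1 : ∑ k, r k ≤ 1) (ht : ∀ k, 0 < t k) (h : ArrayHL 𝕜 r t C) :
    1 / t 0 ≤ 1 - ∑ k, r k := by
  refine le_of_forall_natCast_rpow_le (C := C) fun n hn => ?_
  have hn' : (0 : ℝ) < n := by exact_mod_cast hn
  have h1 := h.mixedSum_le ht hn (n := n) (M := (n : ℝ) ^ (1 - ∑ k, r k)) (by positivity)
    (a := fun j => if Fin.tail j = fun _ => j 0 then 1 else 0) (fun u w hu hw => ?_)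
  · refine le_trans (le_of_eq ?_) h1
    have e : ∀ (l : Fin n), mixedSum (Fin.tail t) (fun i =>
        ‖(if Fin.tail (Fin.cons l i : Fin (m + 1) → Fin n) =
          fun _ => (Fin.cons l i : Fin (m + 1) → Fin n) 0 then (1 : 𝕜) else 0)‖) = 1 := by
      intro l
      rw [← mixedSum_indicator (t := Fin.tail t) (fun k => ht k.succ) fun _ => l]
      congr 1
      ext i
      rw [Fin.tail_cons, Fin.cons_zero]
      split_ifs <;> simp
    rw [mixedSum_succ]
    simp only [e, Real.one_rpow, Finset.sum_const, Finset.card_univ, Fintype.card_fin,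
      nsmul_eq_mul, mul_one]
  · have e : ∑ j : Fin (m + 1) → Fin n, (if Fin.tail j = fun _ => j 0 then (1 : 𝕜) else 0) *
        ∏ k, (u k (j k) * ((w k (j k) ^ r k : ℝ) : 𝕜)) =
        ∑ l, ∏ k, (u k l * ((w k l ^ r k : ℝ) : 𝕜)) := by
      rw [sum_fin_succ_pi]
      refine Finset.sum_congr rfl fun l _ => ?_
      rw [Finset.sum_eq_single fun _ => l]
      · simp only [Fin.tail_cons, Fin.cons_zero, if_true, one_mul]
        rw [Fin.prod_univ_succ, Fin.prod_univ_succ]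
        simp
      · intro i _ hi
        rw [Fin.tail_cons, Fin.cons_zero, if_neg hi, zero_mul]
      · simp
    rw [e]
    refine (norm_sum_le _ _).trans (le_trans (Finset.sum_le_sum fun l _ => ?_)
      (sum_prod_rpow_le hr hr1 hn hw))
    rw [norm_prod]
    refine Finset.prod_le_prod (fun k _ => norm_nonneg _) fun k _ => ?_
    have := Real.rpow_nonneg ((hw k).1 l) (r k)
    rw [norm_mul, RCLike.norm_ofReal, abs_of_nonneg this]
    exact mul_le_of_le_one_left this (hu k l)

lemma ArrayHL.one_div_le {r t : Fin m → ℝ} {C : ℝ} (hr : ∀ k, 0 ≤ r k)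
    (hr1 : ∑ k, r k ≤ 1) (ht : ∀ k, 0 < t k) (h : ArrayHL 𝕜 r t C) (k : Fin m) :
    1 / t k ≤ 1 - rTail r k := by
  induction m with
  | zero => exact k.elim0
  | succ m ih =>
    induction k using Fin.cases with
    | zero => rw [rTail_zero]; exact h.one_div_zero_le hr hr1 ht
    | succ k =>
      rw [rTail_succ]
      refine ih (fun k => hr k.succ) ?_ (fun k => ht k.succ) (h.tail (hr 0) ht) k
      rw [Fin.sum_univ_succ] at hr1
      have := hr 0
      have e : ∑ k, Fin.tail r k = ∑ k : Fin m, r k.succ := rfl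
      linarith

end LowerBound

/-! ### Sign choices by exponential moments, and nets -/

section RandomSigns

/-- The method of conditional expectations for a sum of hyperbolic cosines. -/
lemma exists_signs_sum_cosh_le {ι J : Type*} [Fintype ι] [DecidableEq J] (c : ι → J → ℝ)
    (s : Finset J) (v : ι → ℝ) :
    ∃ ε : J → ℝ, (∀ j, ε j = 1 ∨ ε j = -1) ∧
      ∑ i, v i * Real.cosh (∑ j ∈ s, ε j * c i j) ≤ ∑ i, v i * ∏ j ∈ s, Real.cosh (c i j) := by
  induction s using Finset.induction_on generalizing v with
  | empty => exact ⟨fun _ => 1, fun _ => Or.inl rfl, by simp⟩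
  | insert j₀ s hj ih =>
    obtain ⟨ε, hε, h⟩ := ih fun i => v i * Real.cosh (c i j₀)
    set X : ι → ℝ := fun i => ∑ j ∈ s, ε j * c i j with hX
    have hsum : ∀ (η : ℝ) i, ∑ j ∈ insert j₀ s, Function.update ε j₀ η j * c i j =
        X i + η * c i j₀ := by
      intro η i
      rw [Finset.sum_insert hj, add_comm, Function.update_self]
      congr 1
      refine Finset.sum_congr rfl fun j hj' => ?_
      rw [Function.update_of_ne (ne_of_mem_of_not_mem hj' hj)]
    have hsgn : ∀ η : ℝ, (η = 1 ∨ η = -1) → ∀ j, Function.update ε j₀ η j = 1 ∨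
        Function.update ε j₀ η j = -1 := by
      intro η hη j
      by_cases hj : j = j₀
      · subst hj; simpa using hη
      · simpa [Function.update_of_ne hj] using hε j
    have key : ∑ i, v i * Real.cosh (X i + c i j₀) + ∑ i, v i * Real.cosh (X i - c i j₀) ≤
        2 * ∑ i, v i * ∏ j ∈ insert j₀ s, Real.cosh (c i j) := by
      calc _ = 2 * ∑ i, v i * Real.cosh (c i j₀) * Real.cosh (X i) := by
            rw [← Finset.sum_add_distrib, Finset.mul_sum]
            refine Finset.sum_congr rfl fun i _ => ?_
            rw [Real.cosh_add, Real.cosh_sub]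
            ring
        _ ≤ 2 * ∑ i, v i * Real.cosh (c i j₀) * ∏ j ∈ s, Real.cosh (c i j) := by linarith
        _ = _ := by
            congr 1
            refine Finset.sum_congr rfl fun i _ => ?_
            rw [Finset.prod_insert hj, mul_assoc]
    rcases le_total (∑ i, v i * Real.cosh (X i + c i j₀))
      (∑ i, v i * ∏ j ∈ insert j₀ s, Real.cosh (c i j)) with h' | h'
    · refine ⟨Function.update ε j₀ 1, hsgn 1 (Or.inl rfl), ?_⟩
      simpa only [hsum, one_mul] using h'
    · refine ⟨Function.update ε j₀ (-1), hsgn (-1) (Or.inr rfl), ?_⟩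
      simp only [hsum, neg_mul, one_mul, ← sub_eq_add_neg]
      linarith

/-- Simultaneous small signed sums. -/
lemma exists_signs_forall_abs_sum_le {ι J : Type*} [Fintype ι] [Nonempty ι] [Fintype J]
    (c : ι → J → ℝ) {V L : ℝ} (hV : ∀ i, ∑ j, c i j ^ 2 ≤ V)
    (hL : Real.log (2 * Fintype.card ι) ≤ L) :
    ∃ ε : J → ℝ, (∀ j, ε j = 1 ∨ ε j = -1) ∧ ∀ i, |∑ j, ε j * c i j| ≤ (1 + V / 2) * √L := by
  classical
  have hcard : (1 : ℝ) ≤ Fintype.card ι := by exact_mod_cast Fintype.card_pos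
  have hL0 : 0 < L := (Real.log_pos (by linarith)).trans_le hL
  have hx0 : 0 < √L := Real.sqrt_pos.2 hL0
  have hx2 : √L ^ 2 = L := Real.sq_sqrt hL0.le
  -- Chernoff parameter `√L`: the moment costs `exp (L * V / 2)`, and the union bound costs `2 *
  -- card ι ≤ exp L`.
  obtain ⟨ε, hε, h⟩ := exists_signs_sum_cosh_le (fun i j => √L * c i j) Finset.univ fun _ => 1
  refine ⟨ε, hε, fun i => ?_⟩
  simp only [one_mul] at h
  have h1 : ∀ i, ∏ j, Real.cosh (√L * c i j) ≤ Real.exp (L * V / 2) := by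
    intro i
    calc ∏ j, Real.cosh (√L * c i j) ≤ ∏ j, Real.exp ((√L * c i j) ^ 2 / 2) :=
          Finset.prod_le_prod (fun j _ => (Real.cosh_pos _).le) fun j _ =>
            Real.cosh_le_exp_half_sq _
      _ = Real.exp (L * (∑ j, c i j ^ 2) / 2) := by
          rw [← Real.exp_sum]
          congr 1
          simp only [mul_pow, hx2]
          rw [← Finset.sum_div, ← Finset.mul_sum]
      _ ≤ _ := by
          gcongr
          exact hV i
  set S := ∑ j, ε j * c i j with hS
  have h2 : Real.cosh (√L * S) ≤ Fintype.card ι * Real.exp (L * V / 2) := by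
    have e : √L * S = ∑ j, ε j * (√L * c i j) := by
      rw [hS, Finset.mul_sum]
      exact Finset.sum_congr rfl fun j _ => by ring
    rw [e]
    refine (Finset.single_le_sum (f := fun i => Real.cosh (∑ j, ε j * (√L * c i j)))
      (fun i _ => (Real.cosh_pos _).le) (Finset.mem_univ i)).trans (h.trans ?_)
    refine (Finset.sum_le_sum fun i _ => h1 i).trans ?_
    rw [Finset.sum_const, Finset.card_univ, nsmul_eq_mul]
  have h3 : Real.exp (√L * |S|) ≤ 2 * Real.cosh (√L * S) := by
    rw [← Real.cosh_abs, abs_mul, abs_of_pos hx0, Real.cosh_eq]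
    have := Real.exp_pos (-(√L * |S|))
    linarith
  have h4 : √L * |S| ≤ L + L * V / 2 := by
    rw [← Real.exp_le_exp, Real.exp_add]
    have h5 : 2 * (Fintype.card ι : ℝ) ≤ Real.exp L := by
      rw [← Real.exp_log (by linarith : (0 : ℝ) < 2 * Fintype.card ι)]
      exact Real.exp_le_exp.2 hL
    have h6 := mul_le_mul_of_nonneg_right h5 (Real.exp_pos (L * V / 2)).le
    linarith
  have h5 : √L * |S| ≤ √L * ((1 + V / 2) * √L) := by
    refine h4.trans (le_of_eq ?_)
    have e : √L * ((1 + V / 2) * √L) = √L ^ 2 * (1 + V / 2) := by ring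
    rw [e, hx2]
    ring
  exact le_of_mul_le_mul_left h5 hx0

variable {𝕜 : Type*} [RCLike 𝕜]

/-- A grid of mesh `1/K` in the square around the disc, each coordinate being rounded down. Over the
reals `RCLike.I = 0` and the second coordinate collapses. -/
lemma exists_finset_approx (K : ℕ) (hK : 0 < K) :
    ∃ G : Finset 𝕜, G.Nonempty ∧ G.card ≤ (2 * K + 1) ^ 2 ∧
      ∀ z : 𝕜, ‖z‖ ≤ 1 → ∃ g ∈ G, ‖z - g‖ ≤ 2 / K := by
  classical
  have hK' : (0 : ℝ) < K := by exact_mod_cast hK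
  set I : Finset ℤ := Finset.Icc (-(K : ℤ)) K with hI
  have hfloor : ∀ x : ℝ, |x| ≤ 1 → ⌊K * x⌋ ∈ I ∧ |x - ⌊K * x⌋ / K| ≤ 1 / K := by
    intro x hx
    rw [abs_le] at hx
    refine ⟨Finset.mem_Icc.2 ⟨Int.le_floor.2 ?_, ?_⟩, ?_⟩
    · push_cast
      nlinarith
    · have : ((⌊K * x⌋ : ℤ) : ℝ) ≤ ((K : ℤ) : ℝ) := by
        refine (Int.floor_le _).trans ?_
        push_cast
        nlinarith
      exact_mod_cast this
    · have h1 := Int.floor_le (K * x)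
      have h2 := Int.lt_floor_add_one (K * x)
      have e : x - ⌊K * x⌋ / K = (K * x - ⌊K * x⌋) / K := by field_simp
      rw [e, abs_div, abs_of_pos hK']
      gcongr
      rw [abs_le]
      constructor <;> linarith
  refine ⟨(I ×ˢ I).image fun q => (((q.1 : ℝ) / K : ℝ) : 𝕜) + (((q.2 : ℝ) / K : ℝ) : 𝕜) * RCLike.I,
    ?_, ?_, fun z hz => ?_⟩
  · refine Finset.Nonempty.image (Finset.Nonempty.product ?_ ?_) _ <;>
    exact ⟨0, by simp [hI]⟩
  · refine Finset.card_image_le.trans (le_of_eq ?_)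
    rw [Finset.card_product, Int.card_Icc, sq]
    have : ((K : ℤ) + 1 - -(K : ℤ)).toNat = 2 * K + 1 := by omega
    rw [this]
  · obtain ⟨h1, h2⟩ := hfloor (RCLike.re z) ((RCLike.abs_re_le_norm z).trans hz)
    obtain ⟨h3, h4⟩ := hfloor (RCLike.im z) ((RCLike.abs_im_le_norm z).trans hz)
    refine ⟨_, Finset.mem_image.2 ⟨(⌊K * RCLike.re z⌋, ⌊K * RCLike.im z⌋),
      Finset.mem_product.2 ⟨h1, h3⟩, rfl⟩, ?_⟩
    have hI1 : ‖(RCLike.I : 𝕜)‖ ≤ 1 := by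
      by_cases h : (RCLike.I : 𝕜) = 0
      · simp [h]
      · exact (RCLike.norm_I_of_ne_zero h).le
    have e : z - ((((⌊K * RCLike.re z⌋ : ℝ) / K : ℝ) : 𝕜) +
        (((⌊K * RCLike.im z⌋ : ℝ) / K : ℝ) : 𝕜) * RCLike.I) =
        ((RCLike.re z - (⌊K * RCLike.re z⌋ : ℝ) / K : ℝ) : 𝕜) +
        ((RCLike.im z - (⌊K * RCLike.im z⌋ : ℝ) / K : ℝ) : 𝕜) * RCLike.I := by
      push_cast
      linear_combination -RCLike.re_add_im z
    rw [e]
    calc _ ≤ |RCLike.re z - (⌊K * RCLike.re z⌋ : ℝ) / K| +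
          |RCLike.im z - (⌊K * RCLike.im z⌋ : ℝ) / K| * ‖(RCLike.I : 𝕜)‖ := by
          refine (norm_add_le _ _).trans ?_
          rw [norm_mul, RCLike.norm_ofReal, RCLike.norm_ofReal]
      _ ≤ 1 / K + 1 / K * 1 := by gcongr
      _ = 2 / K := by ring

end RandomSigns

/-! ### Unimodular forms of small norm -/

section FlatForm

variable {𝕜 : Type*} [RCLike 𝕜] {d N : ℕ}

/-- Unimodular arrays which are small on all tuples of points of a fine grid. -/
lemma exists_signs_forall_grid (G : Finset 𝕜) (hG : G.Nonempty) {L : ℝ}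
    (hL : Real.log (4 * (G.card : ℝ) ^ (N * d)) ≤ L) :
    ∃ a : (Fin d → Fin N) → 𝕜, (∀ j, ‖a j‖ = 1) ∧ ∀ g : Fin d → Fin N → 𝕜, (∀ k l, g k l ∈ G) →
      (∀ k, ∑ l, ‖g k l‖ ^ 2 ≤ 4) → ‖∑ j, a j * ∏ k, g k (j k)‖ ≤ 2 * (1 + 4 ^ d / 2) * √L := by
  classical
  -- Grid tuples outside the ball of radius `2` get the zero vector, so the variance bound `4 ^ d`
  -- holds for every index of the union bound.
  let e : (Fin d → Fin N → G) → (Fin d → Fin N) → 𝕜 := fun g j =>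
    if ∀ k, ∑ l, ‖(g k l : 𝕜)‖ ^ 2 ≤ 4 then ∏ k, (g k (j k) : 𝕜) else 0
  have he : ∀ g, ∑ j, ‖e g j‖ ^ 2 ≤ 4 ^ d := by
    intro g
    by_cases h : ∀ k, ∑ l, ‖(g k l : 𝕜)‖ ^ 2 ≤ 4
    · simp only [e, if_pos h, norm_prod, ← Finset.prod_pow]
      have := Finset.prod_univ_sum (fun _ : Fin d => (Finset.univ : Finset (Fin N)))
        (fun k l => ‖(g k l : 𝕜)‖ ^ 2)
      rw [Fintype.piFinset_univ] at this
      rw [← this]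
      calc _ ≤ ∏ _k : Fin d, (4 : ℝ) :=
            Finset.prod_le_prod (fun k _ => by positivity) fun k _ => h k
        _ = 4 ^ d := by simp
    · simp only [e, if_neg h]
      simp
  -- The flag separates real and imaginary parts; this doubles the number of sums and explains the
  -- `4` in `hL`.
  let c : (Fin d → Fin N → G) × Bool → (Fin d → Fin N) → ℝ := fun i j =>
    if i.2 then RCLike.re (e i.1 j) else RCLike.im (e i.1 j)
  have hc : ∀ i, ∑ j, c i j ^ 2 ≤ 4 ^ d := by
    rintro ⟨g, b⟩
    refine le_trans (Finset.sum_le_sum fun j _ => ?_) (he g)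
    rw [← sq_abs]
    cases b
    · have := RCLike.abs_im_le_norm (e g j)
      simp only [c, Bool.false_eq_true, if_false]
      gcongr
    · have := RCLike.abs_re_le_norm (e g j)
      simp only [c, if_true]
      gcongr
  have : Nonempty G := hG.to_subtype
  have hcard : (2 * Fintype.card ((Fin d → Fin N → G) × Bool) : ℝ) =
      4 * (G.card : ℝ) ^ (N * d) := by
    simp [Fintype.card_prod, pow_mul]
    ring
  obtain ⟨ε, hε, h⟩ := exists_signs_forall_abs_sum_le c hc (L := L) (by rw [hcard]; exact hL)
  refine ⟨fun j => (ε j : 𝕜), fun j => ?_, fun g hg h4 => ?_⟩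
  · rcases hε j with h | h <;> simp [h]
  · let g' : Fin d → Fin N → G := fun k l => ⟨g k l, hg k l⟩
    have hg' : ∀ j, e g' j = ∏ k, g k (j k) := fun j => if_pos h4
    have h1 := h (g', true)
    have h2 := h (g', false)
    simp only [c, if_true, Bool.false_eq_true, if_false, hg'] at h1 h2
    have h3 : ∀ z : 𝕜, ‖z‖ ≤ |RCLike.re z| + |RCLike.im z| := by
      intro z
      have hI1 : ‖(RCLike.I : 𝕜)‖ ≤ 1 := by
        by_cases h : (RCLike.I : 𝕜) = 0
        · simp [h]
        · exact (RCLike.norm_I_of_ne_zero h).le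
      conv_lhs => rw [← RCLike.re_add_im z]
      refine (norm_add_le _ _).trans ?_
      rw [norm_mul, RCLike.norm_ofReal, RCLike.norm_ofReal]
      gcongr
      exact mul_le_of_le_one_right (abs_nonneg _) hI1
    refine (h3 _).trans ?_
    simp only [map_sum, RCLike.re_ofReal_mul, RCLike.im_ofReal_mul]
    linarith

lemma norm_le_of_forall_unit {p : Fin d → ℝ≥0∞} [∀ k, Fact (1 ≤ p k)]
    (f : ContinuousMultilinearMap 𝕜 (fun k => ell 𝕜 (p k) N) 𝕜) {M : ℝ} (hM : 0 ≤ M)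
    (h : ∀ x : ∀ k, ell 𝕜 (p k) N, (∀ k, ‖x k‖ ≤ 1) → ‖f x‖ ≤ M) : ‖f‖ ≤ M := by
  refine f.opNorm_le_bound hM fun x => ?_
  have h1 := h (fun k => ((‖x k‖⁻¹ : ℝ) : 𝕜) • x k) fun k => by
    rw [norm_smul, RCLike.norm_ofReal, abs_of_nonneg (by positivity)]
    exact inv_mul_le_one
  have h2 : x = fun k => (‖x k‖ : 𝕜) • ((‖x k‖⁻¹ : ℝ) : 𝕜) • x k := by
    ext1 k
    rcases eq_or_ne (x k) 0 with h | h
    · simp [h]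
    · have : (‖x k‖ : 𝕜) ≠ 0 := by simpa using h
      rw [smul_smul, RCLike.ofReal_inv, mul_inv_cancel₀ this, one_smul]
  calc ‖f x‖ = ‖f fun k => (‖x k‖ : 𝕜) • ((‖x k‖⁻¹ : ℝ) : 𝕜) • x k‖ := by rw [← h2]
    _ = (∏ k, ‖x k‖) * ‖f fun k => ((‖x k‖⁻¹ : ℝ) : 𝕜) • x k‖ := by
        rw [f.map_smul_univ, norm_smul, norm_prod]
        simp
    _ ≤ (∏ k, ‖x k‖) * M := by gcongr
    _ = _ := mul_comm _ _

/-- Unimodular arrays whose forms have small norm on Euclidean spaces. -/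
lemma exists_unimodular_formOfArray_norm_le (d : ℕ) (hd : 0 < d) :
    ∃ D : ℝ, 0 < D ∧ ∀ N : ℕ, 0 < N → ∃ a : (Fin d → Fin N) → 𝕜, (∀ j, ‖a j‖ = 1) ∧
      ‖formOfArray (fun _ : Fin d => 2) a‖ ≤ D * √(N * (1 + Real.log N)) := by
  -- Mesh `1/(κN)` gives Euclidean error at most `2/κ = 1/(d 2^d)` per vector, just enough for a
  -- change of `‖f‖/2` in the form on balls of radius `2`, while the logarithm of the number of grid
  -- tuples stays `O(N (1 + log N))`.
  set κ : ℕ := d * 2 ^ (d + 1) with hκ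
  have hκ0 : 0 < κ := by positivity
  have hκ1 : (1 : ℝ) ≤ κ := by exact_mod_cast hκ0
  set B : ℝ := Real.log 4 + d * Real.log (9 * κ ^ 2) + 2 * d with hB
  have hd1 : (1 : ℝ) ≤ d := by exact_mod_cast hd
  have hl4 : 0 ≤ Real.log 4 := Real.log_nonneg (by norm_num)
  have hlκ : 0 ≤ Real.log (9 * κ ^ 2) := Real.log_nonneg (by nlinarith)
  have hB0 : 0 < B := by positivity
  refine ⟨4 * (1 + 4 ^ d / 2) * √B, by positivity, fun N hN => ?_⟩
  have hN1 : (1 : ℝ) ≤ N := by exact_mod_cast hN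
  have hlN : 0 ≤ Real.log N := Real.log_nonneg hN1
  obtain ⟨G, hG0, hGc, hG⟩ := exists_finset_approx (𝕜 := 𝕜) (κ * N) (by positivity)
  have hGcard : (G.card : ℝ) ≤ 9 * κ ^ 2 * N ^ 2 := by
    have h1 : (G.card : ℝ) ≤ (2 * (κ * N) + 1) ^ 2 := by exact_mod_cast hGc
    have h2 : 1 ≤ (κ : ℝ) * N := by nlinarith
    calc _ ≤ _ := h1
      _ ≤ (3 * (κ * N : ℝ)) ^ 2 := by gcongr; linarith
      _ = _ := by ring
  have hGpos : (1 : ℝ) ≤ G.card := by exact_mod_cast hG0.card_pos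
  have hlog : Real.log (4 * (G.card : ℝ) ^ (N * d)) ≤ B * (N * (1 + Real.log N)) := by
    rw [Real.log_mul (by norm_num) (by positivity), Real.log_pow]
    have h1 : Real.log G.card ≤ Real.log (9 * κ ^ 2) + 2 * Real.log N := by
      calc _ ≤ Real.log (9 * κ ^ 2 * N ^ 2) := Real.log_le_log (by linarith) hGcard
        _ = _ := by
            rw [Real.log_mul (by positivity) (by positivity), ← Real.log_rpow (by linarith) 2,
              Real.rpow_two]
    have h2 : ((N * d : ℕ) : ℝ) * Real.log G.card ≤
        (N * d) * (Real.log (9 * κ ^ 2) + 2 * Real.log N) := by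
      push_cast
      gcongr
    have h3 : Real.log 4 ≤ Real.log 4 * (N * (1 + Real.log N)) :=
      le_mul_of_one_le_right hl4 (by nlinarith)
    have h4 : (N * d : ℝ) * Real.log (9 * κ ^ 2) ≤
        (d * Real.log (9 * κ ^ 2)) * (N * (1 + Real.log N)) := by
      have : 0 ≤ (N * d : ℝ) * Real.log (9 * κ ^ 2) * Real.log N := by positivity
      nlinarith
    have h5 : (N * d : ℝ) * (2 * Real.log N) ≤ (2 * d) * (N * (1 + Real.log N)) := by
      have : 0 ≤ (2 * d : ℝ) * N := by positivity
      nlinarith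
    rw [hB]
    linarith
  obtain ⟨a, ha, h⟩ := exists_signs_forall_grid (d := d) (N := N) G hG0 hlog
  refine ⟨a, ha, ?_⟩
  set f := formOfArray (fun _ : Fin d => 2) a with hf
  set τ := 2 * (1 + 4 ^ d / 2) * √(B * (N * (1 + Real.log N))) with hτ
  have hτ0 : 0 ≤ τ := by positivity
  have hδ : (2 / (κ * N) : ℝ) * √N ≤ 1 / (d * 2 ^ d) := by
    have h1 : √(N : ℝ) ≤ N := by
      rw [Real.sqrt_le_left (by positivity)]
      nlinarith
    calc (2 / (κ * N) : ℝ) * √N ≤ 2 / (κ * N) * N := by gcongr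
      _ = 1 / (d * 2 ^ d) := by
          rw [hκ]
          push_cast
          field_simp
          ring
  have hδ1 : (1 / (d * 2 ^ d) : ℝ) ≤ 1 := by
    rw [div_le_one (by positivity)]
    have : (1 : ℝ) ≤ 2 ^ d := one_le_pow₀ (by norm_num)
    nlinarith
  -- The approximation error is proportional to the unknown norm and is absorbed on the left.
  have key : ‖f‖ ≤ τ + ‖f‖ / 2 := by
    refine norm_le_of_forall_unit f (by positivity) fun x hx => ?_
    have hx1 : ∀ k l, ‖x k l‖ ≤ 1 := fun k l => (PiLp.norm_apply_le (x k) l).trans (hx k)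
    choose g hgG hg using fun k l => hG (x k l) (hx1 k l)
    set y : Fin d → ell 𝕜 2 N := fun k => WithLp.toLp 2 (g k) with hy
    have hxy : ∀ k, ‖x k - y k‖ ≤ 1 / (d * 2 ^ d) := by
      intro k
      refine le_trans ?_ hδ
      rw [PiLp.norm_eq_of_L2]
      calc √(∑ l, ‖(x k - y k) l‖ ^ 2) ≤ √(∑ _l : Fin N, (2 / (κ * N) : ℝ) ^ 2) := by
            gcongr with l
            have := hg k l
            push_cast at this
            exact this
        _ = _ := by
            rw [Finset.sum_const, Finset.card_univ, Fintype.card_fin, nsmul_eq_mul, mul_comm,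
              Real.sqrt_mul (by positivity), Real.sqrt_sq (by positivity)]
    have hy2 : ∀ k, ‖y k‖ ≤ 2 := by
      intro k
      have h1 : ‖y k‖ ≤ ‖x k‖ + ‖x k - y k‖ := by
        rw [norm_sub_rev]
        exact norm_le_norm_add_norm_sub' (y k) (x k)
      linarith [hx k, hxy k]
    have hfy : ‖f y‖ ≤ τ := by
      rw [hf, formOfArray_apply]
      refine h g hgG fun k => ?_
      have h1 : ∑ l, ‖g k l‖ ^ 2 = ‖y k‖ ^ 2 := by
        rw [PiLp.norm_sq_eq_of_L2]
      rw [h1]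
      have := hy2 k
      nlinarith [norm_nonneg (y k)]
    have hdiff : ‖f x - f y‖ ≤ ‖f‖ / 2 := by
      refine (f.norm_image_sub_le x y).trans ?_
      have h1 : max ‖x‖ ‖y‖ ≤ 2 := by
        refine max_le ?_ ?_
        · exact (pi_norm_le_iff_of_nonneg (by norm_num)).2 fun k => by linarith [hx k]
        · exact (pi_norm_le_iff_of_nonneg (by norm_num)).2 hy2
      have h2 : ‖x - y‖ ≤ 1 / (d * 2 ^ d) :=
        (pi_norm_le_iff_of_nonneg (by positivity)).2 hxy
      rw [Fintype.card_fin]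
      calc ‖f‖ * d * max ‖x‖ ‖y‖ ^ (d - 1) * ‖x - y‖ ≤
          ‖f‖ * d * 2 ^ (d - 1) * (1 / (d * 2 ^ d)) := by gcongr
        _ = ‖f‖ / 2 := by
            have h3 : (2 : ℝ) ^ d = 2 ^ (d - 1) * 2 := by rw [← pow_succ, Nat.sub_add_cancel hd]
            rw [h3]
            field_simp
    calc ‖f x‖ ≤ ‖f y‖ + ‖f x - f y‖ := norm_le_norm_add_norm_sub' _ _
      _ ≤ _ := add_le_add hfy hdiff
  have e : 4 * (1 + 4 ^ d / 2) * √B * √(N * (1 + Real.log N)) = 2 * τ := by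
    rw [hτ, Real.sqrt_mul hB0.le]
    ring
  rw [e]
  linarith

/-- Hölder against the constant vector: the norm of the inclusion of `ℓ_{1/r}` into `ℓ₂`. It
transfers Euclidean bounds to the spaces at hand. -/
lemma norm_toLp_two_le (hN : 0 < N) {r : ℝ} (hr : 0 ≤ r) (hr2 : r ≤ 1 / 2) {u : Fin N → 𝕜}
    {w : Fin N → ℝ} (hu : ∀ l, ‖u l‖ ≤ 1) (hw : IsSubprob w) :
    ‖(WithLp.toLp 2 fun l => u l * ((w l ^ r : ℝ) : 𝕜) : ell 𝕜 2 N)‖ ≤ (N : ℝ) ^ (1 / 2 - r) := by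
  have hN' : (0 : ℝ) < N := by exact_mod_cast hN
  have h1 := sum_rpow_mul_rpow_le Finset.univ hw.1 (b := fun _ => (1 : ℝ)) (fun _ => zero_le_one)
    (θ := 2 * r) (by linarith) (by linarith)
  simp only [Real.one_rpow, mul_one, Finset.sum_const, Finset.card_univ, Fintype.card_fin,
    nsmul_eq_mul] at h1
  have h2 : (∑ l, w l) ^ (2 * r) ≤ 1 :=
    Real.rpow_le_one (Finset.sum_nonneg fun l _ => hw.1 l) hw.2 (by linarith)
  have h3 : ∑ l, w l ^ (2 * r) ≤ (N : ℝ) ^ (1 - 2 * r) :=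
    h1.trans (mul_le_of_le_one_left (by positivity) h2)
  rw [PiLp.norm_eq_of_L2, Real.sqrt_le_left (by positivity)]
  calc ∑ l, ‖u l * ((w l ^ r : ℝ) : 𝕜)‖ ^ 2 ≤ ∑ l, w l ^ (2 * r) := by
        refine Finset.sum_le_sum fun l _ => ?_
        have hwl := Real.rpow_nonneg (hw.1 l) r
        rw [norm_mul, RCLike.norm_ofReal, abs_of_nonneg hwl, mul_comm 2 r, Real.rpow_mul (hw.1 l),
          Real.rpow_two]
        gcongr
        exact mul_le_of_le_one_left hwl (hu l)
    _ ≤ _ := h3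
    _ = _ := by
        rw [← Real.rpow_natCast, ← Real.rpow_mul hN'.le]
        congr 1
        push_cast
        ring

lemma formBound_of_norm_formOfArray_le (hN : 0 < N) {r : Fin d → ℝ} (hr : ∀ k, 0 ≤ r k)
    (hr2 : ∀ k, r k ≤ 1 / 2) {a : (Fin d → Fin N) → 𝕜} {M : ℝ}
    (h : ‖formOfArray (fun _ : Fin d => 2) a‖ ≤ M) :
    FormBound r a (M * (N : ℝ) ^ ∑ k, (1 / 2 - r k)) := by
  intro u w hu hw
  have hN' : (0 : ℝ) < N := by exact_mod_cast hN
  have h1 := (formOfArray (fun _ : Fin d => 2) a).le_of_opNorm_le h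
    fun k => WithLp.toLp 2 fun l => u k l * ((w k l ^ r k : ℝ) : 𝕜)
  rw [formOfArray_apply] at h1
  refine h1.trans ?_
  rw [Real.rpow_sum_of_pos hN']
  have hM : 0 ≤ M := (norm_nonneg _).trans h
  gcongr with k
  exact norm_toLp_two_le hN (hr k) (hr2 k) (hu k) (hw k)

/-- Compares powers of `N` for the random-sign form: its iterated sum is `N ^ ∑ 1/t k`, its norm is
at most about `N ^ (1/2 + ∑ (1/2 - r k))`. The logarithm costs an arbitrarily small power `N ^ δ`.
-/
lemma ArrayHL.sum_one_div_le {r t : Fin (d + 1) → ℝ} {C : ℝ} (hr : ∀ k, 0 ≤ r k)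
    (hr2 : ∀ k, r k ≤ 1 / 2) (ht : ∀ k, 0 < t k) (h : ArrayHL 𝕜 r t C) :
    ∑ k, (1 / t k + r k - 1 / 2) ≤ 1 / 2 := by
  obtain ⟨D, hD, hN⟩ := exists_unimodular_formOfArray_norm_le (𝕜 := 𝕜) (d + 1) d.succ_pos
  refine le_of_forall_pos_le_add fun δ hδ => ?_
  have key : ∑ k, 1 / t k ≤ ∑ k, (1 / 2 - r k) + (1 / 2 + δ) := by
    refine le_of_forall_natCast_rpow_le (C := |C| * (D * √(1 + 1 / (2 * δ)))) fun N hN0 => ?_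
    have hN' : (0 : ℝ) < N := by exact_mod_cast hN0
    have hN1 : (1 : ℝ) ≤ N := by exact_mod_cast hN0
    have hlN : 0 ≤ Real.log N := Real.log_nonneg hN1
    obtain ⟨a, ha, hn⟩ := hN N hN0
    have h1 := h.mixedSum_le ht hN0 (by positivity)
      (formBound_of_norm_formOfArray_le hN0 hr hr2 hn)
    simp only [ha] at h1
    rw [mixedSum_one ht, ← Real.rpow_sum_of_pos hN'] at h1
    have h2 : √(N * (1 + Real.log N)) ≤ √(1 + 1 / (2 * δ)) * (N : ℝ) ^ (1 / 2 + δ) := by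
      have h3 : 1 + Real.log N ≤ (1 + 1 / (2 * δ)) * (N : ℝ) ^ (2 * δ) := by
        have h4 := Real.log_le_rpow_div hN'.le (by positivity : 0 < 2 * δ)
        have h5 : (1 : ℝ) ≤ (N : ℝ) ^ (2 * δ) := Real.one_le_rpow hN1 (by positivity)
        have h6 : (1 + 1 / (2 * δ)) * (N : ℝ) ^ (2 * δ) =
            (N : ℝ) ^ (2 * δ) + (N : ℝ) ^ (2 * δ) / (2 * δ) := by ring
        linarith
      calc √(N * (1 + Real.log N)) ≤ √((1 + 1 / (2 * δ)) * ((N : ℝ) ^ (1 / 2 + δ)) ^ 2) := by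
            refine Real.sqrt_le_sqrt ?_
            calc (N : ℝ) * (1 + Real.log N) ≤ N * ((1 + 1 / (2 * δ)) * (N : ℝ) ^ (2 * δ)) := by
                  gcongr
              _ = (1 + 1 / (2 * δ)) * ((N : ℝ) ^ (1 : ℝ) * (N : ℝ) ^ (2 * δ)) := by
                  rw [Real.rpow_one]; ring
              _ = _ := by
                  rw [← Real.rpow_add hN', ← Real.rpow_natCast, ← Real.rpow_mul hN'.le]
                  congr 2
                  push_cast
                  ring
        _ = _ := by rw [Real.sqrt_mul (by positivity), Real.sqrt_sq (by positivity)]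
    calc (N : ℝ) ^ ∑ k, 1 / t k ≤
        C * (D * √(N * (1 + Real.log N)) * (N : ℝ) ^ ∑ k, (1 / 2 - r k)) := h1
      _ ≤ |C| * (D * √(N * (1 + Real.log N)) * (N : ℝ) ^ ∑ k, (1 / 2 - r k)) := by
          gcongr
          exact le_abs_self C
      _ ≤ |C| * (D * (√(1 + 1 / (2 * δ)) * (N : ℝ) ^ (1 / 2 + δ)) *
          (N : ℝ) ^ ∑ k, (1 / 2 - r k)) := by gcongr
      _ = _ := by rw [Real.rpow_add hN' (∑ k, (1 / 2 - r k))]; ring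
  have e : ∑ k, (1 / t k + r k - 1 / 2) = ∑ k, 1 / t k - ∑ k, (1 / 2 - r k) := by
    rw [← Finset.sum_sub_distrib]
    exact Finset.sum_congr rfl fun k _ => by ring
  linarith

lemma ArrayHL.rTail_le {m : ℕ} {r t : Fin m → ℝ} {C : ℝ} (hr : ∀ k, 0 ≤ r k) (ht : ∀ k, 0 < t k)
    (h : ArrayHL 𝕜 r t C) (k : Fin m) (hr2 : ∀ i, k ≤ i → r i ≤ 1 / 2) :
    rTail (fun i => 1 / t i + r i - 1 / 2) k ≤ 1 / 2 := by
  induction m with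
  | zero => exact k.elim0
  | succ m ih =>
    induction k using Fin.cases with
    | zero =>
      rw [rTail_zero]
      exact h.sum_one_div_le hr (fun i => hr2 i (Fin.zero_le i)) ht
    | succ k =>
      rw [rTail_succ]
      exact ih (fun k => hr k.succ) (fun k => ht k.succ) (h.tail (hr 0) ht) k
        fun i hi => hr2 i.succ (Fin.succ_le_succ_iff.2 hi)

end FlatForm

end HardyLittlewood

/-! ### Assembly -/

theorem theorem9876 (𝕜 : Type*) [RCLike 𝕜] (m : ℕ) (hm : 2 ≤ m) :
    ∃ C : ℝ, ∀ (p : Fin m → ENNReal) [∀ k, Fact (1 ≤ p k)],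
      1 / 2 ≤ ∑ k, ((p k)⁻¹).toReal → ∑ k, ((p k)⁻¹).toReal < 1 →
      ∀ k₀ : Fin m, IsGreatest {t : Fin m | 1 / 2 ≤ HardyLittlewood.tailSum p t} k₀ →
        HardyLittlewood.HLInequality 𝕜 p (HardyLittlewood.hlExponent p k₀) C ∧
        (∀ k ≤ k₀, HardyLittlewood.IsOptimalExponent 𝕜 p k (HardyLittlewood.hlExponent p k₀ k)) ∧
        (2 ≤ p k₀ → HardyLittlewood.GloballySharp 𝕜 p (HardyLittlewood.hlExponent p k₀)) := by
  open HardyLittlewood in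
  refine ⟨(16 / 9) ^ m, fun p _ _ hp1 k₀ hk₀ => ?_⟩
  set r : Fin m → ℝ := fun k => ((p k)⁻¹).toReal with hr_def
  have hr : ∀ k, 0 ≤ r k := fun k => ENNReal.toReal_nonneg
  have hs : hlExponent p k₀ = rExponent r k₀ := rfl
  have hpos := rExponent_pos hr hp1 k₀
  have hHL : HLInequality 𝕜 p (hlExponent p k₀) ((16 / 9) ^ m) :=
    ArrayHL.hlInequality hpos fun n _ a ha => ha.mixedSum_rExponent_le hr hp1 hk₀
  have hadm : Admissible 𝕜 p (hlExponent p k₀) := ⟨hpos, _, hHL⟩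
  have hlow : ∀ k ≤ k₀, ∀ t, Admissible 𝕜 p t → hlExponent p k₀ k ≤ t k := by
    rintro k hk t ⟨ht, C, hC⟩
    have h1 := hC.arrayHL.one_div_le hr hp1.le ht k
    have h2 := rTail_le_sum hr k
    rw [hs, rExponent, if_pos hk, inv_le_comm₀ (by linarith) (ht k), ← one_div]
    exact h1
  refine ⟨hHL, fun k hk => ⟨⟨_, hadm, rfl⟩, ?_⟩, fun h2 => ⟨hadm, fun j ε hε hadm' => ?_⟩⟩
  · rintro _ ⟨t, ht, rfl⟩
    exact hlow k hk t ht
  · rcases le_or_gt j k₀ with hj | hj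
    · have := hlow j hj _ hadm'
      rw [Function.update_self] at this
      linarith
    · obtain ⟨ht, C, hC⟩ := hadm'
      -- At `k₀` this is the hypothesis `2 ≤ p k₀`; beyond `k₀` it follows from maximality, since `r
      -- i` is at most its own tail sum.
      have hhalf : ∀ i, k₀ ≤ i → r i ≤ 1 / 2 := by
        intro i hi
        rcases hi.eq_or_lt with rfl | hi
        · have h3 : (p k₀)⁻¹ ≤ 2⁻¹ := ENNReal.inv_le_inv.2 h2
          have h4 := ENNReal.toReal_mono (by simp) h3
          simpa [hr_def] using h4
        · by_contra! hlt
          have h3 : r i ≤ rTail r i :=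
            Finset.single_le_sum (fun k _ => hr k) (Finset.mem_Ici.2 le_rfl)
          have h4 : i ≤ k₀ := hk₀.2 (show 1 / 2 ≤ rTail r i by linarith)
          exact absurd hi (not_lt.2 h4)
      have h3 := hC.arrayHL.rTail_le hr ht k₀ hhalf
      -- Beyond `k₀` each term is `r i`, and these cancel the tail in `1 / s_{k₀} = 1 - rTail r k₀`.
      -- The necessary condition is thus saturated, and decreasing any later exponent violates it.
      have h4 : rTail (fun i => 1 / hlExponent p k₀ i + r i - 1 / 2) k₀ = 1 / 2 := by
        have e : Finset.Ici k₀ = insert k₀ (Finset.Ioi k₀) := (Finset.Ioi_insert k₀).symm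
        have h5 : rTail r k₀ = r k₀ + ∑ i ∈ Finset.Ioi k₀, r i := by
          rw [rTail, e, Finset.sum_insert (by simp)]
        rw [rTail, e, Finset.sum_insert (by simp), hs]
        have h6 : ∀ i ∈ Finset.Ioi k₀, 1 / rExponent r k₀ i + r i - 1 / 2 = r i := by
          intro i hi
          rw [rExponent, if_neg (not_le.2 (Finset.mem_Ioi.1 hi))]
          ring
        rw [Finset.sum_congr rfl h6, rExponent, if_pos le_rfl, one_div, inv_inv, h5]
        ring
      have h5 : rTail (fun i => 1 / hlExponent p k₀ i + r i - 1 / 2) k₀ <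
          rTail (fun i => 1 / Function.update (hlExponent p k₀) j (hlExponent p k₀ j - ε) i +
            r i - 1 / 2) k₀ := by
        refine Finset.sum_lt_sum (fun i _ => ?_) ⟨j, Finset.mem_Ici.2 hj.le, ?_⟩
        · by_cases hij : i = j
          · subst hij
            have h6 := ht i
            rw [Function.update_self] at h6 ⊢
            have := one_div_le_one_div_of_le h6 (by linarith : _ ≤ hlExponent p k₀ i)
            linarith
          · rw [Function.update_of_ne hij]
        · have h6 := ht j
          rw [Function.update_self] at h6 ⊢
          have := one_div_lt_one_div_of_lt h6 (by linarith : _ < hlExponent p k₀ j)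
          linarith
      linarith
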